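/- Let $G$ be a Polish group. A $G$-system is a near-action of $G$ on a standard Borel probability space $(X,\mathcal X,\mu)$, i.e. a Borel map $G\times X\to X$, $(g,x)\mapsto gx$, such that $ex=x$ for a.e. $x$, for each pair $g,h\in G$ one has $g(hx)=(gh)x$ for a.e. $x$ (the null set may depend on $g,h$), and each $g\in G$ preserves $\mu$. A factor map $(X,\mu)\to(Y,\nu)$ of $G$-systems is a Borel map $\pi$ with $\pi_*\mu=\nu$ such that for each $g\in G$, $\pi(gx)=g\pi(x)$ for a.e. $x$; then $(Y,\nu)$ is called a factor of $(X,\mu)$. An isomorphism is a pair of factor maps in opposite directions that are inverse to each other almost everywhere. A $G$-system is spatial if it is isomorphic to a $G$-system on a standard Borel probability space for which $ex=x$ and $g(hx)=(gh)x$ hold for all $g,h\in G$ and all $x$. A $G$-system is whirly if for all $A,B\in\mathcal X$ of positive measure, every neighborhood of $e$ contains some $g$ with $\mu(A\cap gB)>0$, where $gB$ is understood modulo null sets, as $\{x: g^{-1}x\in B\}$. A joining of two $G$-systems $(X,\mu)$ and $(Y,\nu)$ is a probability measure on $X\times Y$ with marginals $\mu$ and $\nu$ that is invariant under $(x,y)\mapsto(gx,gy)$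 for every $g\in G$; the two systems are disjoint if $\mu\times\nu$ is their only joining. **Theorem.** 1. Every factor of a spatial $G$-system is a spatial $G$-system. 2. A $G$-system is whirly if and only if it is disjoint from every spatial $G$-system. -/

import Mathlib

open MeasureTheory Topology

universe u v

/-- A near-action (a `G`-system) of `G` on `(X, μ)`: a jointly Borel map `G × X → X` which
satisfies the action axioms almost everywhere (the null set may depend on the group elements) and
such that each `g` preserves `μ`. -/
structure NearAction (G : Type v) [Group G] [MeasurableSpace G] {X : Type u} [MeasurableSpace X]
    (μ : Measure X) where
  /-- The map `(g, x) ↦ g x`. -/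
  act : G → X → X
  measurable_act : Measurable (fun p : G × X => act p.1 p.2)
  one_act : ∀ᵐ x ∂μ, act 1 x = x
  act_act : ∀ g h : G, ∀ᵐ x ∂μ, act g (act h x) = act (g * h) x
  measurePreserving_act : ∀ g : G, MeasurePreserving (act g) μ μ

namespace NearAction

variable {G : Type v} [Group G] [MeasurableSpace G]
  {X Y : Type u} [MeasurableSpace X] [MeasurableSpace Y] {μ : Measure X} {ν : Measure Y}

/-- The near-action is a spatial action: a genuine (everywhere defined) Borel action of `G` by
measure-preserving maps. -/
def IsSpatialAction (S : NearAction G μ) : Prop :=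
  (∀ x : X, S.act 1 x = x) ∧ ∀ (g h : G) (x : X), S.act g (S.act h x) = S.act (g * h) x

/-- `π` is a factor map: measurable, carrying `μ` to `ν`, and such that for each `g` it
intertwines the actions of `g` almost everywhere. -/
def IsFactorMap (S : NearAction G μ) (T : NearAction G ν) (π : X → Y) : Prop :=
  MeasurePreserving π μ ν ∧ ∀ g : G, ∀ᵐ x ∂μ, π (S.act g x) = T.act g (π x)

/-- `T` is a factor of `S`. -/
def IsFactorOf (T : NearAction G ν) (S : NearAction G μ) : Prop :=
  ∃ π : X → Y, IsFactorMap S T π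

/-- Isomorphism of near-actions: factor maps in both directions, inverse to each other almost
everywhere. -/
def IsIsomorphic (S : NearAction G μ) (T : NearAction G ν) : Prop :=
  ∃ (φ : X → Y) (ψ : Y → X), IsFactorMap S T φ ∧ IsFactorMap T S ψ ∧
    (∀ᵐ x ∂μ, ψ (φ x) = x) ∧ ∀ᵐ y ∂ν, φ (ψ y) = y

/-- The `G`-system is spatial: it admits a spatial model, i.e. it is isomorphic to a spatial
action of `G` on a standard Borel probability space. -/
def IsSpatial {X : Type u} [MeasurableSpace X] {μ : Measure X} (S : NearAction G μ) : Prop :=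
  ∃ (Y : Type u) (_ : MeasurableSpace Y) (_ : StandardBorelSpace Y)
    (ν : Measure Y) (_ : IsProbabilityMeasure ν) (T : NearAction G ν),
    T.IsSpatialAction ∧ S.IsIsomorphic T

/-- The `G`-system is whirly: for all `A`, `B` of positive measure, every neighbourhood of the
identity contains some `g` with `μ (A ∩ gB) > 0`. As each `g` acts invertibly only up to null
sets, the element `gB` of the measure algebra is represented by the preimage of `B` under `g⁻¹`. -/
def IsWhirly [TopologicalSpace G] (S : NearAction G μ) : Prop :=
  ∀ A B : Set X, MeasurableSet A → MeasurableSet B → 0 < μ A → 0 < μ B →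
    ∀ U ∈ 𝓝 (1 : G), ∃ g ∈ U, 0 < μ (A ∩ S.act g⁻¹ ⁻¹' B)

/-- `l` is a joining of `S` and `T`: a measure on `X × Y` with marginals `μ` and `ν`, invariant
under the diagonal action of `G`. -/
def IsJoining (S : NearAction G μ) (T : NearAction G ν) (l : Measure (X × Y)) : Prop :=
  l.map Prod.fst = μ ∧ l.map Prod.snd = ν ∧
    ∀ g : G, l.map (Prod.map (S.act g) (T.act g)) = l

/-- `S` and `T` are disjoint: their only joining is the product measure. -/
def IsDisjointFrom (S : NearAction G μ) (T : NearAction G ν) : Prop :=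
  ∀ l : Measure (X × Y), IsJoining S T l → l = μ.prod ν

end NearAction

/-! Everything passes through norm continuous functions: Borel `f` with `‖f ∘ g - f‖_∞ → 0` as `g →
1`. The pivot is that a system is spatial exactly when the norm continuous functions with values in
`[0, 1]` are `L¹`-dense among Borel functions with values in `[0, 1]` (`HasDenseNormContinuous`).

Spatial implies dense. For a genuine Borel action and a Borel set `A`, measure how far from `1` one
must go, in a group seminorm and ignoring meagre sets of group elements, to move `x` into `A`. This
is Borel in `x` by Montgomery–Novikov and 1-Lipschitz along orbits. Countably many such functions
separate points, hence embed `X` in a compact cube, and continuous functions on the cube are norm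
continuous on `X` and dense.

Dense implies spatial. If `f n` are norm continuous, then for almost every `x` the maps `g ↦ f n (g
x)` agree on a countable dense set with uniformly continuous functions having fixed moduli. Such
functions form a compact metrizable space on which `G` acts continuously by right translation. When
the `f n` converge to a Borel embedding of `X`, the resulting equivariant map is almost everywhere
invertible.

Density passes to factors because conditional expectation commutes with the action and contracts
both `L^∞` and `L¹`; this is the first claim.

On a whirly system norm continuous functions are constant. In a joining with a spatial system,
project a norm continuous function of the spatial coordinate to the whirly one: the result is
constant, and density forces the product measure. Conversely, a failure of whirliness at `A`, `B`
gives a norm continuous function separating `A` from `B`, hence a spatial factor whose graph joining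
is not the product. -/

open Filter Set

/-! ### Group seminorms and the topology at the identity -/

/-- The topology of a first countable group is given at the identity by a group seminorm. -/
theorem exists_groupSeminorm_nhds_one_eq_comap (G : Type*) [Group G] [TopologicalSpace G]
    [IsTopologicalGroup G] [FirstCountableTopology G] :
    ∃ ρ : GroupSeminorm G, 𝓝 (1 : G) = comap ρ (𝓝 0) := by
  let := IsTopologicalGroup.rightUniformSpace G
  have hU : uniformity G = comap (fun p : G × G => p.2 * p.1⁻¹) (𝓝 (1 : G)) := rfl
  have : (uniformity G).IsCountablyGenerated := by rw [hU]; infer_instance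
  let := UniformSpace.pseudoMetricSpace G
  have hb (g : G) : BddAbove (range fun k : G => min (dist (g * k) k) 1) :=
    ⟨1, by rintro _ ⟨k, rfl⟩; exact min_le_right _ _⟩
  -- The supremum over right translates gives subadditivity and symmetry; truncation at `1` keeps it
  -- finite. It tends to `0` at `1` because right uniform entourages constrain only `(g * k) * k⁻¹ =
  -- g`.
  have hle (g k : G) : min (dist (g * k) k) 1 ≤ ⨆ k : G, min (dist (g * k) k) 1 :=
    le_ciSup (hb g) k
  let ρ : GroupSeminorm G :=
    { toFun := fun g => ⨆ k : G, min (dist (g * k) k) 1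
      map_one' := by simp
      mul_le' := fun g h => ciSup_le fun k => by
        have h1 := hle g (h * k)
        have h2 := hle h k
        have h3 := dist_triangle (g * h * k) (h * k) k
        rw [← mul_assoc] at h1
        rcases min_choice (dist (g * h * k) (h * k)) 1 with e | e <;>
        rcases min_choice (dist (h * k) k) 1 with e' | e' <;>
        rw [e] at h1 <;> rw [e'] at h2
        · exact (min_le_left _ _).trans (by linarith)
        all_goals
          refine (min_le_right _ _).trans ?_
          have := (dist_nonneg (x := g * h * k) (y := h * k))
          have := (dist_nonneg (x := h * k) (y := k))
          linarith
      inv' := by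
        have key (g : G) : (⨆ k : G, min (dist (g⁻¹ * k) k) 1) ≤
            ⨆ k : G, min (dist (g * k) k) 1 := ciSup_le fun k => by
          have := hle g (g⁻¹ * k)
          rwa [mul_inv_cancel_left, dist_comm] at this
        intro g
        refine le_antisymm (key g) ?_
        simpa using key g⁻¹ }
  refine ⟨ρ, le_antisymm (map_le_iff_le_comap.1 ?_) ?_⟩
  · refine Metric.tendsto_nhds.2 fun ε hε => ?_
    have h := Metric.dist_mem_uniformity (α := G) (half_pos hε)
    rw [hU] at h
    obtain ⟨V, hV, hVs⟩ := h
    filter_upwards [hV] with g hg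
    have h0 : ρ g ≤ ε / 2 := ciSup_le fun k => by
      have : (k, g * k) ∈ (fun p : G × G => p.2 * p.1⁻¹) ⁻¹' V := by simpa using hg
      have := hVs this
      refine (min_le_left _ _).trans ?_
      rw [dist_comm]
      exact le_of_lt this
    rw [Real.dist_eq, sub_zero, abs_of_nonneg (apply_nonneg ρ g)]
    linarith
  · intro U hU'
    obtain ⟨ε, hε, hs⟩ := Metric.mem_nhds_iff.1 hU'
    refine ⟨Iio (min ε 1), Iio_mem_nhds (lt_min hε one_pos), fun g hg => hs ?_⟩
    have h1 : min (dist g 1) 1 ≤ ρ g := by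
      have := hle g 1
      rwa [mul_one] at this
    have h2 : min (dist g 1) 1 < min ε 1 := h1.trans_lt hg
    rw [Metric.mem_ball]
    by_contra! h
    exact absurd h2 (not_lt.2 (min_le_min_right _ h))

/-! ### Baire category of sections -/

section Category

variable {X : Type*} [MeasurableSpace X] {G : Type*} [TopologicalSpace G]

theorem IsMeagre.of_residualEq {s t : Set G} (ht : IsMeagre t) (h : s =ᵇ t) : IsMeagre s := by
  unfold IsMeagre at *
  filter_upwards [ht, h.mem_iff] with x hx hxt hs
  exact hx (hxt.1 hs)

/-- The Montgomery–Novikov theorem: the set of points over which the section of a Borel set is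
meagre is Borel. -/
theorem measurableSet_setOf_isMeagre_section [SecondCountableTopology G] [BaireSpace G]
    [MeasurableSpace G] [BorelSpace G] {B : Set (X × G)} (hB : MeasurableSet B) :
    MeasurableSet {x | IsMeagre {g | (x, g) ∈ B}} := by
  set b := TopologicalSpace.countableBasis G
  have hb := TopologicalSpace.isBasis_countableBasis G
  -- Localising to every open `U` at once is what makes the induction pass complements.
  suffices h : ∀ U, IsOpen U → MeasurableSet {x | IsMeagre ({g | (x, g) ∈ B} ∩ U)} by
    simpa using h univ isOpen_univ
  have hB' := hB
  rw [← generateFrom_prod] at hB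
  induction B, hB using MeasurableSpace.generateFrom_induction with
  | hC t ht _ =>
    obtain ⟨s, hs, c, -, rfl⟩ := ht
    intro U _
    by_cases hc : IsMeagre (c ∩ U)
    · convert MeasurableSet.univ
      refine eq_univ_of_forall fun x => hc.mono ?_
      rintro g ⟨hg, hgU⟩
      exact ⟨hg.2, hgU⟩
    · convert MeasurableSet.compl hs using 1
      ext x
      simp only [mem_ofPred_eq, mem_compl_iff]
      constructor
      · intro h hx
        refine hc (h.mono ?_)
        rintro g ⟨hg, hgU⟩
        exact ⟨⟨hx, hg⟩, hgU⟩
      · intro hx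
        refine IsMeagre.empty.mono ?_
        rintro g ⟨hg, -⟩
        exact hx hg.1
  | empty => intro U _; simp [IsMeagre.empty]
  | compl t ht ih =>
    intro U hU
    have htm : MeasurableSet t := by rwa [← generateFrom_prod]
    have ih := ih htm
    -- By the Baire property, the complement is meagre in `U` unless it is comeagre in some nonempty
    -- basic `V ⊆ U`, that is, unless `t` is meagre in `V`.
    have : {x | IsMeagre ({g | (x, g) ∈ tᶜ} ∩ U)} =
        ⋂ V ∈ {V ∈ b | V ⊆ U ∧ V.Nonempty}, {x | IsMeagre ({g | (x, g) ∈ t} ∩ V)}ᶜ := by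
      ext x
      simp only [mem_ofPred_eq, mem_iInter, mem_compl_iff]
      constructor
      · rintro h V ⟨hVb, hVU, hV⟩ h'
        refine not_isMeagre_of_isOpen (hb.isOpen hVb) hV ((h.union h').mono fun g hg => ?_)
        by_cases hgt : (x, g) ∈ t
        · exact Or.inr ⟨hgt, hg⟩
        · exact Or.inl ⟨hgt, hVU hg⟩
      · intro h
        have hm : MeasurableSet {g | (x, g) ∈ tᶜ} := measurable_prodMk_left htm.compl
        obtain ⟨O, hO, hOeq⟩ := hm.residualEq_isOpen
        rcases (O ∩ U).eq_empty_or_nonempty with he | ⟨g, hg⟩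
        · refine IsMeagre.of_residualEq (t := O ∩ U) (by rw [he]; exact IsMeagre.empty) ?_
          exact hOeq.inter (EventuallyEq.refl _ _)
        · obtain ⟨V, hVb, hgV, hV⟩ := hb.exists_subset_of_mem_open hg (hO.inter hU)
          refine absurd ?_ (h V ⟨hVb, hV.trans inter_subset_right, g, hgV⟩)
          refine IsMeagre.mono (s := {g | (x, g) ∈ t} ∩ O)
            (fun g hg => ⟨hg.1, (hV hg.2).1⟩) ?_
          refine IsMeagre.of_residualEq (t := {g | (x, g) ∈ t} ∩ {g | (x, g) ∈ tᶜ}) ?_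
            ((EventuallyEq.refl _ _).inter hOeq.symm)
          convert IsMeagre.empty
          exact inter_compl_self {g | (x, g) ∈ t}
    rw [this]
    refine MeasurableSet.biInter
      ((TopologicalSpace.countable_countableBasis G).mono fun V hV => hV.1) fun V hV => ?_
    exact (ih V (hb.isOpen hV.1)).compl
  | iUnion s hs ih =>
    intro U hU
    have : {x | IsMeagre ({g | (x, g) ∈ ⋃ n, s n} ∩ U)} =
        ⋂ n, {x | IsMeagre ({g | (x, g) ∈ s n} ∩ U)} := by
      ext x
      simp only [mem_ofPred_eq, mem_iInter]
      constructor
      · intro h n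
        refine h.mono ?_
        rintro g ⟨hg, hgU⟩
        exact ⟨mem_iUnion.2 ⟨n, hg⟩, hgU⟩
      · intro h
        refine (isMeagre_iUnion h).mono ?_
        rintro g ⟨hg, hgU⟩
        obtain ⟨n, hn⟩ := mem_iUnion.1 hg
        exact mem_iUnion.2 ⟨n, hn, hgU⟩
    rw [this]
    exact MeasurableSet.iInter fun n => ih n (by rw [← generateFrom_prod]; exact hs n) U hU

end Category

theorem GroupSeminorm.continuous_of_tendsto_nhds_one {G : Type*} [Group G] [TopologicalSpace G]
    [IsTopologicalGroup G] {ρ : GroupSeminorm G} (hρ : Tendsto ρ (𝓝 1) (𝓝 0)) : Continuous ρ := by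
  refine continuous_iff_continuousAt.2 fun h => tendsto_iff_dist_tendsto_zero.2 ?_
  have h1 : Tendsto (fun g => ρ (g * h⁻¹)) (𝓝 h) (𝓝 0) := by
    refine hρ.comp ?_
    simpa using (continuous_mul_const h⁻¹).tendsto h
  refine squeeze_zero (fun _ => dist_nonneg) (fun g => ?_) h1
  have h2 := map_mul_le_add ρ (g * h⁻¹) h
  have h3 := map_mul_le_add ρ (g * h⁻¹)⁻¹ g
  rw [map_inv_eq_map] at h3
  simp only [mul_inv_rev, inv_inv, inv_mul_cancel_right] at h2 h3
  rw [Real.dist_eq, abs_le]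
  constructor <;> linarith

/-! ### Category distances for a spatial action -/

namespace NearAction

section CategoryDistance

variable {G : Type*} [Group G] [MeasurableSpace G] [TopologicalSpace G]
  {X : Type*} [MeasurableSpace X] {μ : Measure X} (S : NearAction G μ) (ρ : GroupSeminorm G)
  (A : Set X)

/-- The distance, in the sense of category and truncated at `1`, from the identity to the set of
group elements moving `x` into `A`. -/
noncomputable def categoryDist (x : X) : ℝ :=
  sSup {c : ℝ | c ≤ 1 ∧ IsMeagre {g : G | ρ g < c ∧ S.act g x ∈ A}}

variable {S ρ A}

theorem bddAbove_categoryDist (x : X) :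
    BddAbove {c : ℝ | c ≤ 1 ∧ IsMeagre {g : G | ρ g < c ∧ S.act g x ∈ A}} :=
  ⟨1, fun _ hc => hc.1⟩

theorem zero_mem_categoryDist (x : X) :
    (0 : ℝ) ∈ {c : ℝ | c ≤ 1 ∧ IsMeagre {g : G | ρ g < c ∧ S.act g x ∈ A}} := by
  refine ⟨zero_le_one, IsMeagre.empty.mono ?_⟩
  rintro g ⟨hg, -⟩
  exact absurd (apply_nonneg ρ g) (not_le.2 hg)

theorem le_categoryDist {x : X} {c : ℝ} (hc : c ≤ 1)
    (h : IsMeagre {g : G | ρ g < c ∧ S.act g x ∈ A}) : c ≤ S.categoryDist ρ A x :=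
  le_csSup (bddAbove_categoryDist x) ⟨hc, h⟩

theorem categoryDist_mem_Icc (x : X) : S.categoryDist ρ A x ∈ Icc (0 : ℝ) 1 :=
  ⟨le_csSup (bddAbove_categoryDist x) (zero_mem_categoryDist x),
    csSup_le ⟨0, zero_mem_categoryDist x⟩ fun _ hc => hc.1⟩

/-- Right multiplication by `h⁻¹` is a homeomorphism, so preserves meagreness, and changes `ρ` by at
most `ρ h`. The action laws are used at every point. -/
theorem IsSpatialAction.categoryDist_act_le [ContinuousMul G] (hS : S.IsSpatialAction) (h : G)
    (x : X) : S.categoryDist ρ A (S.act h x) ≤ S.categoryDist ρ A x + ρ h := by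
  refine csSup_le ⟨0, zero_mem_categoryDist _⟩ ?_
  rintro c ⟨hc, hm⟩
  rw [← sub_le_iff_le_add]
  refine le_categoryDist (by linarith [apply_nonneg ρ h]) ?_
  refine (hm.preimage_of_isOpenMap (Homeomorph.mulRight h⁻¹).continuous
    (Homeomorph.mulRight h⁻¹).isOpenMap).mono ?_
  rintro g ⟨hg, hgA⟩
  refine ⟨?_, ?_⟩
  · have := map_mul_le_add ρ g h⁻¹
    rw [map_inv_eq_map] at this
    simp only [Homeomorph.coe_mulRight]
    linarith
  · simpa [hS.2] using hgA

theorem IsSpatialAction.abs_categoryDist_act_sub_le [ContinuousMul G] (hS : S.IsSpatialAction)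
    (h : G) (x : X) : |S.categoryDist ρ A (S.act h x) - S.categoryDist ρ A x| ≤ ρ h := by
  have h1 := hS.categoryDist_act_le (ρ := ρ) (A := A) h x
  have h2 := hS.categoryDist_act_le (ρ := ρ) (A := A) h⁻¹ (S.act h x)
  rw [hS.2, inv_mul_cancel, hS.1, map_inv_eq_map] at h2
  rw [abs_le]
  constructor <;> linarith

theorem measurable_categoryDist [SecondCountableTopology G] [BaireSpace G] [BorelSpace G]
    (hρ : Measurable ρ) (hA : MeasurableSet A) : Measurable (S.categoryDist ρ A) := by
  refine measurable_of_Ioi fun a => ?_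
  have : S.categoryDist ρ A ⁻¹' Ioi a = ⋃ q ∈ {q : ℚ | a < q ∧ (q : ℝ) ≤ 1},
      {x | IsMeagre {g : G | ρ g < q ∧ S.act g x ∈ A}} := by
    ext x
    simp only [mem_preimage, mem_Ioi, mem_iUnion, mem_ofPred_eq, exists_prop]
    constructor
    · intro h
      obtain ⟨c, ⟨hc, hm⟩, hac⟩ := exists_lt_of_lt_csSup ⟨0, zero_mem_categoryDist x⟩ h
      obtain ⟨q, hq, hqc⟩ := exists_rat_btwn hac
      refine ⟨q, ⟨hq, hqc.le.trans hc⟩, hm.mono ?_⟩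
      rintro g ⟨hg, hgA⟩
      exact ⟨hg.trans hqc, hgA⟩
    · rintro ⟨q, ⟨hq, hq1⟩, hm⟩
      exact hq.trans_le (le_categoryDist hq1 hm)
  rw [this]
  refine MeasurableSet.biUnion (to_countable _) fun q _ => ?_
  refine measurableSet_setOf_isMeagre_section
    (B := {p : X × G | ρ p.2 < q ∧ S.act p.2 p.1 ∈ A}) ?_
  exact (measurableSet_lt (hρ.comp measurable_snd) measurable_const).inter
    ((S.measurable_act.comp measurable_swap) hA)

/-- Countably many category distances separate the points. -/
theorem IsSpatialAction.exists_categoryDist_ne [SecondCountableTopology G] [BaireSpace G]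
    [BorelSpace G] [IsTopologicalGroup G]
    (hS : S.IsSpatialAction) (hρ : 𝓝 (1 : G) = comap ρ (𝓝 0)) {ι : Type*} [Countable ι]
    {B : ι → Set X} (hB : ∀ i, MeasurableSet (B i))
    (hsep : ∀ x y, x ≠ y → ∃ i, x ∈ B i ∧ y ∉ B i) {D : Set G} (hD : Dense D) {x y : X}
    (hxy : x ≠ y) :
    ∃ i, ∃ h ∈ D, S.categoryDist ρ (B i) (S.act h x) ≠ S.categoryDist ρ (B i) (S.act h y) := by
  have hinj (g : G) : S.act g x ≠ S.act g y := fun h => hxy <| by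
    have := congrArg (S.act g⁻¹) h
    simpa [hS.2, hS.1] using this
  -- Every `g` keeps `x` and `y` apart, so these countably many sets cover the Baire space `G`.
  obtain ⟨i, hi⟩ : ∃ i, ¬ IsMeagre {g | S.act g x ∈ B i ∧ S.act g y ∉ B i} := by
    by_contra! h
    refine not_isMeagre_of_isOpen (isOpen_univ (X := G)) univ_nonempty
      ((isMeagre_iUnion h).mono fun g _ => ?_)
    exact mem_iUnion.2 (hsep _ _ (hinj g))
  have hm (z : X) : MeasurableSet {g | S.act g z ∈ B i} :=
    (S.measurable_act.comp measurable_prodMk_right) (hB i)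
  obtain ⟨V, hV, hVeq⟩ := ((hm x).inter (hm y).compl).residualEq_isOpen
  have hVne : V.Nonempty := by
    by_contra! h
    rw [h] at hVeq
    exact hi (IsMeagre.empty.of_residualEq hVeq)
  -- For `g` near `1`, generically `g * h` moves `x` into `B i` and `y` outside it. So the distance
  -- vanishes at `h x` and is positive at `h y`.
  obtain ⟨h, hhV, hhD⟩ := hD.inter_open_nonempty V hV hVne
  refine ⟨i, h, hhD, ne_of_lt ?_⟩
  have hW : (fun g => g * h) ⁻¹' V ∈ 𝓝 (1 : G) :=
    (hV.preimage (continuous_mul_const h)).mem_nhds (by simpa using hhV)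
  have hpre {s t : Set G} (hst : s =ᵇ t) : (fun g => g * h) ⁻¹' s =ᵇ (fun g => g * h) ⁻¹' t :=
    (tendsto_residual_of_isOpenMap (continuous_mul_const h)
      (Homeomorph.mulRight h).isOpenMap).eventually hst
  have hxle : S.categoryDist ρ (B i) (S.act h x) ≤ 0 := by
    refine csSup_le ⟨0, zero_mem_categoryDist _⟩ ?_
    rintro c ⟨-, hc⟩
    by_contra! hc0
    have h1 : {g | ρ g < c} ∈ 𝓝 (1 : G) := by
      rw [hρ]
      exact ⟨Iio c, Iio_mem_nhds hc0, fun g hg => hg⟩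
    obtain ⟨O, hOs, hO, hO1⟩ := mem_nhds_iff.1 (inter_mem h1 hW)
    refine not_isMeagre_of_isOpen hO ⟨1, hO1⟩ ?_
    have h2 : IsMeagre ((fun g => g * h) ⁻¹' ({g | S.act g x ∈ B i} ∩ {g | S.act g y ∈ B i}ᶜ)
        ∩ {g | ρ g < c}) := by
      refine hc.mono ?_
      rintro g ⟨⟨hg, -⟩, hgc⟩
      refine ⟨hgc, ?_⟩
      rw [hS.2]
      exact hg
    have h3 := h2.of_residualEq ((hpre hVeq).symm.inter (EventuallyEq.refl _ {g | ρ g < c}))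
    refine h3.mono ?_
    intro g hg
    exact ⟨(hOs hg).2, (hOs hg).1⟩
  refine hxle.trans_lt ?_
  rw [hρ] at hW
  obtain ⟨N, hN, hNV⟩ := hW
  obtain ⟨δ, hδ, hδN⟩ := Metric.mem_nhds_iff.1 hN
  refine (lt_min hδ one_pos).trans_le (le_categoryDist (min_le_right _ _) ?_)
  have h4 : IsMeagre ((fun g => g * h) ⁻¹' {g | S.act g y ∈ B i} ∩ (fun g => g * h) ⁻¹' V) := by
    refine IsMeagre.of_residualEq (t := ∅) IsMeagre.empty ?_
    refine ((EventuallyEq.refl _ _).inter (hpre hVeq).symm).trans (Eq.eventuallyEq ?_)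
    ext g
    exact ⟨fun H => H.2.2 H.1, False.elim⟩
  refine h4.mono ?_
  rintro g ⟨hg, hgB⟩
  refine ⟨?_, hNV (hδN ?_)⟩
  · rw [hS.2] at hgB
    exact hgB
  · rw [Metric.mem_ball, Real.dist_eq, sub_zero, abs_of_nonneg (apply_nonneg ρ g)]
    exact hg.trans_le (min_le_left _ _)

end CategoryDistance

/-! ### Norm continuous functions and their density -/

section Density

variable {G : Type*} [Group G] [MeasurableSpace G] [TopologicalSpace G]
  {X : Type*} [MeasurableSpace X] {μ : Measure X} (S : NearAction G μ)

/-- The orbit map of `f` is continuous at the identity for the essential supremum norm. -/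
def IsNormContinuous (f : X → ℝ) : Prop :=
  ∀ ε > 0, ∀ᶠ g in 𝓝 (1 : G), ∀ᵐ x ∂μ, |f (S.act g x) - f x| ≤ ε

/-- The norm continuous functions with values in `[0, 1]` are dense in `L¹` among all measurable
functions with values in `[0, 1]`. -/
def HasDenseNormContinuous : Prop :=
  ∀ e : X → ℝ, Measurable e → (∀ x, e x ∈ Icc (0 : ℝ) 1) → ∀ ε : ENNReal, ε ≠ 0 →
    ∃ f : X → ℝ, Measurable f ∧ (∀ x, f x ∈ Icc (0 : ℝ) 1) ∧ S.IsNormContinuous f ∧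
      eLpNorm (f - e) 1 μ ≤ ε

variable {S}

theorem IsNormContinuous.comp_lipschitz {f : X → ℝ} (hf : S.IsNormContinuous f) {φ : ℝ → ℝ}
    (hφ : ∀ a b, |φ a - φ b| ≤ |a - b|) : S.IsNormContinuous fun x => φ (f x) := by
  intro ε hε
  filter_upwards [hf ε hε] with g hg
  filter_upwards [hg] with x hx
  exact (hφ _ _).trans hx

theorem abs_max_min_sub_le (a b : ℝ) :
    |max 0 (min 1 a) - max 0 (min 1 b)| ≤ |a - b| :=
  (abs_max_sub_max_le_max 0 _ 0 _).trans <| by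
    rw [sub_zero, abs_zero, max_eq_right (abs_nonneg _)]
    refine (abs_min_sub_min_le_max 1 a 1 b).trans ?_
    rw [sub_self, abs_zero, max_eq_right (abs_nonneg _)]

/-- A spatial action admits countably many norm continuous Borel functions which separate the
points. -/
theorem IsSpatialAction.exists_separating_uniform [IsTopologicalGroup G] [PolishSpace G]
    [BorelSpace G] [StandardBorelSpace X] (hS : S.IsSpatialAction) :
    ∃ f : (ℕ × Bool) × ℕ → X → ℝ, (∀ i, Measurable (f i)) ∧ (∀ i x, f i x ∈ Icc (0 : ℝ) 1) ∧
      (∀ i, ∀ ε > 0, ∀ᶠ g in 𝓝 (1 : G), ∀ x, |f i (S.act g x) - f i x| ≤ ε) ∧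
      ∀ x y, (∀ i, f i x = f i y) → x = y := by
  obtain ⟨ρ, hρ⟩ := exists_groupSeminorm_nhds_one_eq_comap G
  have hρ0 : Tendsto ρ (𝓝 1) (𝓝 0) := hρ ▸ tendsto_comap
  have hρc : Continuous ρ := GroupSeminorm.continuous_of_tendsto_nhds_one hρ0
  -- The `Bool` index includes complements, since separation is needed in the one-sided form `x ∈ B
  -- i`, `y ∉ B i`.
  let B : ℕ × Bool → Set X := fun p => {x | MeasurableSpace.mapNatBool X x p.1 = p.2}
  have hB (i) : MeasurableSet (B i) :=
    ((measurable_pi_apply i.1).comp (MeasurableSpace.measurable_mapNatBool X))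
      (measurableSet_singleton i.2)
  have hsep (x y : X) (hxy : x ≠ y) : ∃ i, x ∈ B i ∧ y ∉ B i := by
    obtain ⟨n, hn⟩ := Function.ne_iff.1 ((MeasurableSpace.injective_mapNatBool X).ne hxy)
    exact ⟨(n, MeasurableSpace.mapNatBool X x n), rfl, fun h => hn h.symm⟩
  let d := TopologicalSpace.denseSeq G
  refine ⟨fun i x => S.categoryDist ρ (B i.1) (S.act (d i.2) x), fun i => ?_, fun i x => ?_,
    fun i ε hε => ?_, fun x y hxy => ?_⟩
  · exact (measurable_categoryDist hρc.measurable (hB _)).comp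
      (S.measurable_act.comp measurable_prodMk_left)
  · exact categoryDist_mem_Icc _
  -- Moving `g` past `d i.2` conjugates it, and conjugation is continuous at `1`.
  · have h1 : Tendsto (fun g => ρ (d i.2 * g * (d i.2)⁻¹)) (𝓝 (1 : G)) (𝓝 0) := by
      refine hρ0.comp ?_
      have : Continuous fun g : G => d i.2 * g * (d i.2)⁻¹ := by fun_prop
      simpa using this.tendsto 1
    filter_upwards [h1.eventually (Iio_mem_nhds hε)] with g hg x
    have h2 := hS.abs_categoryDist_act_sub_le (ρ := ρ) (A := B i.1) (d i.2 * g * (d i.2)⁻¹)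
      (S.act (d i.2) x)
    rw [hS.2, inv_mul_cancel_right] at h2
    rw [hS.2]
    exact h2.trans (le_of_lt hg)
  · by_contra hne
    obtain ⟨i, h, ⟨n, rfl⟩, hi⟩ := hS.exists_categoryDist_ne hρ hB hsep
      (TopologicalSpace.denseRange_denseSeq G) hne
    exact hi (hxy (i, n))

theorem IsSpatialAction.hasDenseNormContinuous [IsTopologicalGroup G] [PolishSpace G]
    [BorelSpace G] [StandardBorelSpace X] [IsProbabilityMeasure μ] (hS : S.IsSpatialAction) :
    S.HasDenseNormContinuous := by
  obtain ⟨f, hfm, hf01, hfu, hfsep⟩ := hS.exists_separating_uniform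
  let Ψ : X → (ℕ × Bool) × ℕ → unitInterval := fun x i => ⟨f i x, hf01 i x⟩
  have hΨm : Measurable Ψ := measurable_pi_lambda _ fun i => (hfm i).subtype_mk
  have hΨ : MeasurableEmbedding Ψ := hΨm.measurableEmbedding fun x y hxy =>
    hfsep x y fun i => congrArg Subtype.val (congrFun hxy i)
  have hΨu : TendstoUniformly (fun g x => Ψ (S.act g x)) Ψ (𝓝 (1 : G)) := by
    rw [tendstoUniformly_iff_tendsto, Pi.uniformity, tendsto_iInf]
    intro i
    rw [tendsto_comap_iff]
    refine tendstoUniformly_iff_tendsto.1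
      (Metric.tendstoUniformly_iff (F := fun g x => Ψ (S.act g x) i) (f := (Ψ · i)).2 ?_)
    intro ε hε
    filter_upwards [hfu i (ε / 2) (half_pos hε)] with g hg x
    rw [dist_comm, Subtype.dist_eq, Real.dist_eq]
    exact (hg x).trans_lt (half_lt_self hε)
  intro e he he01 ε hε
  obtain ⟨e', he', hee⟩ := hΨ.exists_measurable_extend he fun _ => ⟨0⟩
  have heL : MemLp e' 1 (μ.map Ψ) := by
    rw [memLp_map_measure_iff he'.aestronglyMeasurable hΨm.aemeasurable, hee]
    refine MemLp.of_bound he.aestronglyMeasurable 1 (.of_forall fun x => ?_)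
    rw [Real.norm_of_nonneg (he01 x).1]
    exact (he01 x).2
  have := Measure.isProbabilityMeasure_map (μ := μ) hΨm.aemeasurable
  obtain ⟨F, hF, -⟩ := heL.exists_boundedContinuous_eLpNorm_sub_le ENNReal.one_ne_top hε
  have hFu : UniformContinuous F := CompactSpace.uniformContinuous_of_continuous F.continuous
  -- Clamping to `[0, 1]` is 1-Lipschitz and fixes the values of `e`, so it spoils neither estimate.
  refine ⟨fun x => max 0 (min 1 (F (Ψ x))), ?_, fun x => ⟨le_max_left _ _, ?_⟩, ?_, ?_⟩
  · exact measurable_const.max (measurable_const.min (F.continuous.measurable.comp hΨm))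
  · exact max_le zero_le_one (min_le_left _ _)
  · refine IsNormContinuous.comp_lipschitz (φ := fun a => max 0 (min 1 a)) (fun δ hδ => ?_)
      abs_max_min_sub_le
    have := Metric.tendstoUniformly_iff.1 (hFu.comp_tendstoUniformly hΨu) δ hδ
    filter_upwards [this] with g hg
    refine .of_forall fun x => ?_
    have := (hg x).le
    rwa [dist_comm, Real.dist_eq] at this
  · refine le_trans ?_ hF
    rw [eLpNorm_map_measure (he'.sub F.continuous.measurable).aestronglyMeasurable
      hΨm.aemeasurable]
    refine eLpNorm_mono fun x => ?_
    have h1 := abs_max_min_sub_le (F (Ψ x)) (e x)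
    rw [min_eq_right (he01 x).2, max_eq_right (he01 x).1, abs_sub_comm (F (Ψ x))] at h1
    have h2 : e x = e' (Ψ x) := (congrFun hee x).symm
    simpa [Real.norm_eq_abs, h2] using h1

end Density

end NearAction

/-! ### Passing to factors by conditional expectation -/

theorem MeasureTheory.MeasurePreserving.setIntegral_preimage_of_measurable {X Y : Type*}
    [MeasurableSpace X] [MeasurableSpace Y] {μ : Measure X} {ν : Measure Y} {f : X → Y} (hf : MeasurePreserving f μ ν)
    {k : Y → ℝ} (hk : Measurable k) {s : Set Y} (hs : MeasurableSet s) :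
    ∫ x in f ⁻¹' s, k (f x) ∂μ = ∫ y in s, k y ∂ν := by
  rw [← hf.map_eq, setIntegral_map hs hk.aestronglyMeasurable hf.measurable.aemeasurable]

namespace NearAction

section Factor

variable {G : Type*} [Group G] [MeasurableSpace G]
  {X Y : Type u} [MeasurableSpace X] [mY : MeasurableSpace Y] {μ : Measure X} {ν : Measure Y}
  {S : NearAction G μ} {T : NearAction G ν} {π : X → Y}

theorem measurable_act_apply (S : NearAction G μ) (g : G) : Measurable (S.act g) :=
  S.measurable_act.comp measurable_prodMk_left

theorem ae_act_inv_act (S : NearAction G μ) (g : G) : ∀ᵐ x ∂μ, S.act g⁻¹ (S.act g x) = x := by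
  filter_upwards [S.act_act g⁻¹ g, S.one_act] with x h1 h2
  rw [h1, inv_mul_cancel, h2]

theorem ae_act {S : NearAction G μ} {p : X → Prop} (h : ∀ᵐ x ∂μ, p x) (g : G) :
    ∀ᵐ x ∂μ, p (S.act g x) :=
  (S.measurePreserving_act g).quasiMeasurePreserving.ae h

theorem integrable_of_mem_Icc [IsFiniteMeasure μ] {f : X → ℝ} (hf : Measurable f)
    (h : ∀ x, f x ∈ Icc (0 : ℝ) 1) : Integrable f μ :=
  .of_bound hf.aestronglyMeasurable 1 <| .of_forall fun x => by
    rw [Real.norm_of_nonneg (h x).1]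
    exact (h x).2

/-- Projecting to a factor commutes with the action. -/
theorem IsFactorMap.setIntegral_act_eq (hπ : IsFactorMap S T π) {f : X → ℝ} {k : Y → ℝ}
    (hf : Measurable f) (hk : Measurable k)
    (h : ∀ C, MeasurableSet C → ∫ y in C, k y ∂ν = ∫ x in π ⁻¹' C, f x ∂μ) (g : G) {C : Set Y}
    (hC : MeasurableSet C) :
    ∫ y in C, k (T.act g y) ∂ν = ∫ x in π ⁻¹' C, f (S.act g x) ∂μ := by
  have hCg : MeasurableSet (T.act g⁻¹ ⁻¹' C) := T.measurable_act_apply g⁻¹ hC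
  have hT : T.act g ⁻¹' (T.act g⁻¹ ⁻¹' C) =ᵐ[ν] C := by
    refine eventuallyEq_set.2 ?_
    filter_upwards [T.ae_act_inv_act g] with y hy
    simp [hy]
  have hS : S.act g ⁻¹' (π ⁻¹' (T.act g⁻¹ ⁻¹' C)) =ᵐ[μ] π ⁻¹' C := by
    refine eventuallyEq_set.2 ?_
    filter_upwards [hπ.2 g, hπ.1.quasiMeasurePreserving.ae (T.ae_act_inv_act g)] with x h1 h2
    simp [h1, h2]
  calc ∫ y in C, k (T.act g y) ∂ν
      = ∫ y in T.act g ⁻¹' (T.act g⁻¹ ⁻¹' C), k (T.act g y) ∂ν := (setIntegral_congr_set hT).symm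
    _ = ∫ y in T.act g⁻¹ ⁻¹' C, k y ∂ν :=
        MeasurePreserving.setIntegral_preimage_of_measurable (T.measurePreserving_act g) hk hCg
    _ = ∫ x in π ⁻¹' (T.act g⁻¹ ⁻¹' C), f x ∂μ := h _ hCg
    _ = ∫ x in S.act g ⁻¹' (π ⁻¹' (T.act g⁻¹ ⁻¹' C)), f (S.act g x) ∂μ :=
        (MeasurePreserving.setIntegral_preimage_of_measurable (S.measurePreserving_act g) hf
          (hπ.1.measurable hCg)).symm
    _ = ∫ x in π ⁻¹' C, f (S.act g x) ∂μ := setIntegral_congr_set hS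

/-- The conditional expectation, on a factor, of a norm continuous function is norm continuous. -/
theorem IsFactorMap.exists_isNormContinuous_condExp [TopologicalSpace G]
    [IsProbabilityMeasure μ] [IsProbabilityMeasure ν] (hπ : IsFactorMap S T π) {f : X → ℝ}
    (hf : Measurable f) (hf01 : ∀ x, f x ∈ Icc (0 : ℝ) 1) (hfc : S.IsNormContinuous f) :
    ∃ k : Y → ℝ, Measurable k ∧ (∀ y, k y ∈ Icc (0 : ℝ) 1) ∧ T.IsNormContinuous k ∧
      k ∘ π =ᵐ[μ] μ[f | mY.comap π] := by
  have hm : mY.comap π ≤ ‹MeasurableSpace X› := hπ.1.measurable.comap_le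
  have hfi : Integrable f μ := integrable_of_mem_Icc hf hf01
  obtain ⟨k₀, hk₀, hk₀e⟩ :=
    (stronglyMeasurable_condExp (μ := μ) (m := mY.comap π) (f := f)).exists_eq_measurable_comp
  have hkm : Measurable fun y => max 0 (min 1 (k₀ y)) :=
    measurable_const.max (measurable_const.min hk₀.measurable)
  have hk01 (y : Y) : (fun y => max 0 (min 1 (k₀ y))) y ∈ Icc (0 : ℝ) 1 :=
    ⟨le_max_left _ _, max_le zero_le_one (min_le_left _ _)⟩
  have hke : (fun y => max 0 (min 1 (k₀ y))) ∘ π =ᵐ[μ] μ[f | mY.comap π] := by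
    have h0 : 0 ≤ᵐ[μ] μ[f | mY.comap π] := condExp_nonneg (.of_forall fun x => (hf01 x).1)
    have h1 : μ[f | mY.comap π] ≤ᵐ[μ] μ[fun _ => (1 : ℝ) | mY.comap π] :=
      condExp_mono hfi (integrable_const _) (.of_forall fun x => (hf01 x).2)
    rw [condExp_const hm] at h1
    filter_upwards [h0, h1] with x h0 h1
    have hx := congrFun hk₀e x
    simp only [Pi.zero_apply] at h0
    simp only [Function.comp_apply] at hx ⊢
    rw [← hx, min_eq_right h1, max_eq_right h0]
  generalize (fun y => max 0 (min 1 (k₀ y))) = k at hkm hk01 hke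
  refine ⟨k, hkm, hk01, fun ε hε => ?_, hke⟩
  -- Integrals over sets of `Y` determine `k`, so almost everywhere bounds on `f ∘ g - f` become
  -- bounds on `k ∘ g - k` by integrating over every `π ⁻¹' C`.
  have hint : ∀ C, MeasurableSet C → ∫ y in C, k y ∂ν = ∫ x in π ⁻¹' C, f x ∂μ := by
    intro C hC
    rw [← setIntegral_condExp hm hfi ⟨C, hC, rfl⟩,
      ← MeasurePreserving.setIntegral_preimage_of_measurable hπ.1 hkm hC]
    exact setIntegral_congr_ae (hπ.1.measurable hC) (hke.mono fun x hx _ => hx)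
  have hki : Integrable k ν := integrable_of_mem_Icc hkm hk01
  filter_upwards [hfc ε hε] with g hg
  have hgm : Measurable fun x => f (S.act g x) := hf.comp (S.measurable_act_apply g)
  have hgi : Integrable (fun x => f (S.act g x)) μ := integrable_of_mem_Icc hgm fun x => hf01 _
  have hkgm : Measurable fun y => k (T.act g y) := hkm.comp (T.measurable_act_apply g)
  have hkgi : Integrable (fun y => k (T.act g y)) ν := integrable_of_mem_Icc hkgm fun x => hk01 _
  have hreal (C : Set Y) (hC : MeasurableSet C) :
      ∫ _ in C, ε ∂ν = ∫ _ in π ⁻¹' C, ε ∂μ := by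
    simp [measureReal_def, hπ.1.measure_preimage hC.nullMeasurableSet]
  have h1 : (fun y => k (T.act g y)) ≤ᵐ[ν] fun y => k y + ε := by
    refine ae_le_of_forall_setIntegral_le hkgi (hki.add (integrable_const _)) fun C hC _ => ?_
    rw [hπ.setIntegral_act_eq hf hkm hint g hC,
      integral_add hki.integrableOn (integrable_const _), hint C hC, hreal C hC,
      ← integral_add hfi.integrableOn (integrable_const _)]
    refine setIntegral_mono_ae hgi.integrableOn
      (hfi.add (integrable_const _)).integrableOn ?_
    filter_upwards [hg] with x hx
    linarith [(abs_le.1 hx).2]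
  have h2 : k ≤ᵐ[ν] fun y => k (T.act g y) + ε := by
    refine ae_le_of_forall_setIntegral_le hki (hkgi.add (integrable_const _)) fun C hC _ => ?_
    rw [integral_add hkgi.integrableOn (integrable_const _),
      hπ.setIntegral_act_eq hf hkm hint g hC, hint C hC, hreal C hC,
      ← integral_add hgi.integrableOn (integrable_const _)]
    refine setIntegral_mono_ae hfi.integrableOn
      (hgi.add (integrable_const _)).integrableOn ?_
    filter_upwards [hg] with x hx
    linarith [(abs_le.1 hx).1]
  filter_upwards [h1, h2] with y h1 h2
  rw [abs_le]
  constructor <;> linarith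

/-- Lift the target to `X`, approximate there, and project back: conditional expectation contracts
`L¹` and fixes functions lifted from the factor. -/
theorem HasDenseNormContinuous.of_isFactorOf [TopologicalSpace G]
    [IsProbabilityMeasure μ] [IsProbabilityMeasure ν] (hS : S.HasDenseNormContinuous)
    (hT : T.IsFactorOf S) : T.HasDenseNormContinuous := by
  obtain ⟨π, hπ⟩ := hT
  intro e he he01 ε hε
  obtain ⟨f, hf, hf01, hfc, hfe⟩ := hS (e ∘ π) (he.comp hπ.1.measurable) (fun x => he01 _) ε hε
  obtain ⟨k, hk, hk01, hkc, hke⟩ := hπ.exists_isNormContinuous_condExp hf hf01 hfc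
  refine ⟨k, hk, hk01, hkc, le_trans ?_ hfe⟩
  have hm : mY.comap π ≤ ‹MeasurableSpace X› := hπ.1.measurable.comap_le
  have hei : Integrable (e ∘ π) μ :=
    integrable_of_mem_Icc (he.comp hπ.1.measurable) fun x => he01 _
  have h1 : μ[e ∘ π | mY.comap π] = e ∘ π :=
    condExp_of_stronglyMeasurable hm
      (he.stronglyMeasurable.comp_measurable (comap_measurable π)) hei
  have h2 : (k - e) ∘ π =ᵐ[μ] μ[f - e ∘ π | mY.comap π] := by
    filter_upwards [hke, condExp_sub (integrable_of_mem_Icc hf hf01) hei (mY.comap π)] with x h3 h4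
    rw [h4, Pi.sub_apply, h1, ← h3]
    rfl
  rw [← eLpNorm_comp_measurePreserving (hk.sub he).aestronglyMeasurable hπ.1,
    eLpNorm_congr_ae h2]
  exact eLpNorm_condExp_le_eLpNorm _ le_rfl

end Factor

end NearAction

/-! ### The compact space of equicontinuous functions on the group -/

section EquicontinuousModel

variable {G : Type*} [Group G]

/-- The sequences of functions `G → [0, 1]` which are right uniformly continuous with the moduli of
continuity prescribed by the sets `U n m`. -/
def equicontinuousFamily (U : ℕ → ℕ → Set G) : Set (G → ℕ → ℝ) :=
  {φ | (∀ g n, φ g n ∈ Icc (0 : ℝ) 1) ∧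
    ∀ n m g h, h ∈ U n m → |φ (h * g) n - φ g n| ≤ 1 / ((m : ℝ) + 1)}

variable {U : ℕ → ℕ → Set G}

theorem isCompact_equicontinuousFamily : IsCompact (equicontinuousFamily U) := by
  have hK : IsCompact (pi univ fun _ : G => pi univ fun _ : ℕ => Icc (0 : ℝ) 1) :=
    isCompact_univ_pi fun _ => isCompact_univ_pi fun _ => isCompact_Icc
  refine hK.of_isClosed_subset ?_ fun φ hφ g _ n _ => hφ.1 g n
  have hev (g : G) (n : ℕ) : Continuous fun φ : G → ℕ → ℝ => φ g n :=
    (continuous_apply n).comp (continuous_apply g)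
  have : equicontinuousFamily U = (⋂ g, ⋂ n, (fun φ : G → ℕ → ℝ => φ g n) ⁻¹' Icc (0 : ℝ) 1) ∩
      ⋂ n, ⋂ m, ⋂ g, ⋂ h, ⋂ (_ : h ∈ U n m),
        {φ : G → ℕ → ℝ | |φ (h * g) n - φ g n| ≤ 1 / ((m : ℝ) + 1)} := by
    ext φ
    simp [equicontinuousFamily]
  rw [this]
  refine (isClosed_iInter fun g => isClosed_iInter fun n => isClosed_Icc.preimage (hev g n)).inter ?_
  refine isClosed_iInter fun n => isClosed_iInter fun m => isClosed_iInter fun g =>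
    isClosed_iInter fun h => isClosed_iInter fun _ => ?_
  exact isClosed_le ((hev _ _).sub (hev _ _)).abs continuous_const

theorem eq_of_forall_abs_sub_le_two_div {a b : ℝ}
    (h : ∀ m : ℕ, |a - b| ≤ 1 / ((m : ℝ) + 1) + 1 / ((m : ℝ) + 1)) : a = b := by
  refine sub_eq_zero.1 (abs_nonpos_iff.1 (ge_of_tendsto' (x := atTop) ?_ h))
  simpa using (tendsto_one_div_add_atTop_nhds_zero_nat (𝕜 := ℝ)).add
    (tendsto_one_div_add_atTop_nhds_zero_nat (𝕜 := ℝ))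

variable [TopologicalSpace G] [IsTopologicalGroup G]

theorem exists_mul_inv_mem_of_denseRange {d : ℕ → G} (hd : DenseRange d) {V : Set G}
    (hV : IsOpen V) (h1 : (1 : G) ∈ V) (g : G) : ∃ k, d k * g⁻¹ ∈ V :=
  hd.exists_mem_open (hV.preimage (continuous_mul_const g⁻¹)) ⟨g, by simpa using h1⟩

theorem eq_of_mem_equicontinuousFamily (hU : ∀ n m, IsOpen (U n m)) (hU1 : ∀ n m, 1 ∈ U n m)
    {d : ℕ → G} (hd : DenseRange d) {φ ψ : G → ℕ → ℝ} (hφ : φ ∈ equicontinuousFamily U)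
    (hψ : ψ ∈ equicontinuousFamily U) (h : ∀ k n, φ (d k) n = ψ (d k) n) : φ = ψ := by
  funext g n
  refine eq_of_forall_abs_sub_le_two_div fun m => ?_
  obtain ⟨k, hk⟩ := exists_mul_inv_mem_of_denseRange hd (hU n m) (hU1 n m) g
  have h1 := hφ.2 n m g _ hk
  have h2 := hψ.2 n m g _ hk
  rw [inv_mul_cancel_right] at h1 h2
  rw [h] at h1
  rw [abs_sub_comm] at h1
  exact (abs_sub_le _ _ _).trans (add_le_add h1 h2)

/-- Values off the dense sequence are ultrafilter limits in `[0, 1]`. Openness of `U n m` lets the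
modulus pass to the limit, and `1 ∈ U n m` forces agreement with `F` along `d`. -/
theorem exists_extend_mem_equicontinuousFamily (hU : ∀ n m, IsOpen (U n m))
    (hU1 : ∀ n m, 1 ∈ U n m) {d : ℕ → G} (hd : DenseRange d) {F : ℕ → ℕ → ℝ}
    (hF : ∀ k n, F k n ∈ Icc (0 : ℝ) 1)
    (hFU : ∀ n m i j, d j * (d i)⁻¹ ∈ U n m → |F j n - F i n| ≤ 1 / ((m : ℝ) + 1)) :
    ∃ φ ∈ equicontinuousFamily U, ∀ k n, φ (d k) n = F k n := by
  have hne (g : G) : (comap d (𝓝 g)).NeBot := comap_neBot_iff_frequently.2 <|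
    (mem_closure_iff_frequently.1 (hd g)).mono fun _ h => h
  let u (g : G) : Ultrafilter ℕ := .of (comap d (𝓝 g))
  have hu (g : G) : Tendsto d (u g) (𝓝 g) := tendsto_comap.mono_left (Ultrafilter.of_le _)
  have hlim (g : G) (n : ℕ) : ∃ L ∈ Icc (0 : ℝ) 1, Tendsto (fun k => F k n) (u g) (𝓝 L) :=
    isCompact_Icc.ultrafilter_le_nhds ((u g).map fun k => F k n)
      (le_principal_iff.2 (mem_map.2 (univ_mem' fun k => hF k n)))
  choose φ hφ01 hφ using hlim
  refine ⟨φ, ⟨hφ01, fun n m g h hh => ?_⟩, fun k n => ?_⟩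
  · have h1 : Tendsto (fun p : ℕ × ℕ => |F p.1 n - F p.2 n|) (u (h * g) ×ˢ u g)
        (𝓝 |φ (h * g) n - φ g n|) :=
      (((hφ _ n).comp tendsto_fst).sub ((hφ _ n).comp tendsto_snd)).abs
    refine le_of_tendsto h1 ?_
    have h2 : Tendsto (fun p : ℕ × ℕ => d p.1 * (d p.2)⁻¹) (u (h * g) ×ˢ u g) (𝓝 h) := by
      simpa using ((hu (h * g)).comp tendsto_fst).mul ((hu g).comp tendsto_snd).inv
    filter_upwards [h2.eventually ((hU n m).mem_nhds hh)] with p hp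
    exact hFU _ _ _ _ hp
  · refine eq_of_forall_abs_sub_le_two_div fun m => ?_
    have h1 : Tendsto (fun j => |F j n - F k n|) (u (d k)) (𝓝 |φ (d k) n - F k n|) :=
      ((hφ _ n).sub tendsto_const_nhds).abs
    have h2 : Tendsto (fun j => d j * (d k)⁻¹) (u (d k)) (𝓝 1) := by
      simpa using (hu (d k)).mul_const (d k)⁻¹
    have h3 : |φ (d k) n - F k n| ≤ 1 / ((m : ℝ) + 1) := by
      refine le_of_tendsto h1 ?_
      filter_upwards [h2.eventually ((hU n m).mem_nhds (hU1 n m))] with j hj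
      exact hFU _ _ _ _ hj
    have : (0 : ℝ) ≤ 1 / ((m : ℝ) + 1) := by positivity
    linarith

/-- Right translation of the functions in an equicontinuous family. -/
def equicontinuousFamily.translate (k : G) (φ : equicontinuousFamily U) : equicontinuousFamily U :=
  ⟨fun g => φ.1 (g * k), fun _ _ => φ.2.1 _ _, fun n m g h hh => by
    simpa [mul_assoc] using φ.2.2 n m (g * k) h hh⟩

/-- Equicontinuity bounds `φ (g * k) - φ (g * k₀)` uniformly in `φ`, which upgrades pointwise
convergence to joint continuity. -/
theorem equicontinuousFamily.continuous_translate (hU : ∀ n m, IsOpen (U n m))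
    (hU1 : ∀ n m, 1 ∈ U n m) :
    Continuous fun p : G × equicontinuousFamily U => translate p.1 p.2 := by
  refine Continuous.subtype_mk (continuous_pi fun g => continuous_pi fun n => ?_) _
  refine continuous_iff_continuousAt.2 fun ⟨k₀, φ₀⟩ => Metric.tendsto_nhds.2 fun ε hε => ?_
  obtain ⟨m, hm⟩ := exists_nat_one_div_lt (half_pos hε)
  have h1 : ∀ᶠ p : G × equicontinuousFamily U in 𝓝 (k₀, φ₀),
      (g * p.1) * (g * k₀)⁻¹ ∈ U n m := by
    have : Continuous fun p : G × equicontinuousFamily U => (g * p.1) * (g * k₀)⁻¹ := by fun_prop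
    exact this.continuousAt.eventually ((hU n m).mem_nhds (by simpa using hU1 n m))
  have h2 : ∀ᶠ p : G × equicontinuousFamily U in 𝓝 (k₀, φ₀),
      dist (p.2.1 (g * k₀) n) (φ₀.1 (g * k₀) n) < ε / 2 := by
    have : Continuous fun p : G × equicontinuousFamily U => p.2.1 (g * k₀) n :=
      (continuous_apply n).comp ((continuous_apply (g * k₀)).comp
        (continuous_subtype_val.comp continuous_snd))
    exact this.continuousAt.eventually (Metric.ball_mem_nhds _ (half_pos hε))
  filter_upwards [h1, h2] with p h1 h2
  have h3 := p.2.2.2 n m (g * k₀) _ h1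
  rw [inv_mul_cancel_right, ← Real.dist_eq] at h3
  calc dist (p.2.1 (g * p.1) n) (φ₀.1 (g * k₀) n)
      ≤ dist (p.2.1 (g * p.1) n) (p.2.1 (g * k₀) n)
        + dist (p.2.1 (g * k₀) n) (φ₀.1 (g * k₀) n) := dist_triangle _ _ _
    _ < ε := by linarith

/-- This makes the family Polish, although it lives in a product indexed by the possibly uncountable
`G`. -/
theorem equicontinuousFamily.isClosedEmbedding_restrict (hU : ∀ n m, IsOpen (U n m))
    (hU1 : ∀ n m, 1 ∈ U n m) {d : ℕ → G} (hd : DenseRange d) :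
    IsClosedEmbedding fun (φ : equicontinuousFamily U) (k n : ℕ) => φ.1 (d k) n := by
  have : CompactSpace (equicontinuousFamily U) :=
    isCompact_iff_compactSpace.1 isCompact_equicontinuousFamily
  refine Continuous.isClosedEmbedding ?_ fun φ ψ h => Subtype.ext ?_
  · exact continuous_pi fun k => continuous_pi fun n =>
      (continuous_apply n).comp ((continuous_apply (d k)).comp continuous_subtype_val)
  · exact eq_of_mem_equicontinuousFamily hU hU1 hd φ.2 ψ.2 fun k n => congrFun (congrFun h k) n

end EquicontinuousModel

/-- The function space model lives in the universe of `G`, while `IsSpatial` asks for that of `X`.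
-/
theorem exists_measurableEquiv_ulift_standardBorelSpace (Z : Type v) [MeasurableSpace Z]
    [StandardBorelSpace Z] : ∃ (W : Type (max u v)) (_ : MeasurableSpace W)
      (_ : StandardBorelSpace W), Nonempty (Z ≃ᵐ W) := by
  let := upgradeStandardBorel Z
  obtain ⟨W, _, ⟨h⟩⟩ : ∃ (W : Type (max u v)) (_ : TopologicalSpace W), Nonempty (W ≃ₜ Z) :=
    ⟨ULift.{u} Z, inferInstance, ⟨Homeomorph.ulift⟩⟩
  have : PolishSpace W := h.isClosedEmbedding.polishSpace
  let _ : MeasurableSpace W := borel W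
  have : BorelSpace W := ⟨rfl⟩
  exact ⟨W, inferInstance, inferInstance, ⟨h.symm.toMeasurableEquiv⟩⟩

/-- Every standard Borel space has a copy in any given universe. -/
theorem exists_measurableEquiv_standardBorelSpace (Z : Type v) [MeasurableSpace Z]
    [StandardBorelSpace Z] : ∃ (W : Type u) (_ : MeasurableSpace W) (_ : StandardBorelSpace W),
      Nonempty (Z ≃ᵐ W) := by
  obtain ⟨s, hs, ⟨e⟩⟩ := exists_subset_real_measurableEquiv Z
  have := hs.standardBorel
  obtain ⟨W, _, _, ⟨e'⟩⟩ := exists_measurableEquiv_ulift_standardBorelSpace.{u} s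
  exact ⟨W, inferInstance, inferInstance, ⟨e.trans e'⟩⟩

/-! ### Construction of spatial models -/

namespace NearAction

variable {G : Type v} [Group G] [MeasurableSpace G] [TopologicalSpace G]
  {X : Type u} [MeasurableSpace X] {μ : Measure X}

/-- Countably many norm continuous functions factor, almost everywhere, through an equivariant map
to a Borel action. -/
theorem exists_equivariant_model [IsTopologicalGroup G] [PolishSpace G] [BorelSpace G]
    (S : NearAction G μ) {f : ℕ → X → ℝ} (hf : ∀ n, Measurable (f n))
    (hf01 : ∀ n x, f n x ∈ Icc (0 : ℝ) 1) (hfc : ∀ n, S.IsNormContinuous (f n)) :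
    ∃ (Z : Type v) (_ : MeasurableSpace Z) (_ : StandardBorelSpace Z) (a : G → Z → Z) (Φ : X → Z)
      (p : ℕ → Z → ℝ), Measurable (fun q : G × Z => a q.1 q.2) ∧ (∀ z, a 1 z = z) ∧
      (∀ g h z, a g (a h z) = a (g * h) z) ∧ Measurable Φ ∧
      (∀ g, ∀ᵐ x ∂μ, Φ (S.act g x) = a g (Φ x)) ∧ (∀ n, Measurable (p n)) ∧
      ∀ n, ∀ᵐ x ∂μ, p n (Φ x) = f n x := by
  have hU (n m : ℕ) : ∃ V : Set G, IsOpen V ∧ 1 ∈ V ∧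
      ∀ g ∈ V, ∀ᵐ x ∂μ, |f n (S.act g x) - f n x| ≤ 1 / ((m : ℝ) + 1) := by
    obtain ⟨V, hV, hVo, hV1⟩ := mem_nhds_iff.1 (hfc n (1 / ((m : ℝ) + 1)) (by positivity))
    exact ⟨V, hVo, hV1, fun g hg => hV hg⟩
  choose U hUo hU1 hUf using hU
  have hae (n m : ℕ) (g g' : G) (h : g' * g⁻¹ ∈ U n m) :
      ∀ᵐ x ∂μ, |f n (S.act g' x) - f n (S.act g x)| ≤ 1 / ((m : ℝ) + 1) := by
    filter_upwards [S.ae_act (hUf n m _ h) g, S.act_act (g' * g⁻¹) g] with x h1 h2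
    rwa [h2, inv_mul_cancel_right] at h1
  let d := TopologicalSpace.denseSeq G
  have hd : DenseRange d := TopologicalSpace.denseRange_denseSeq G
  have hcl := equicontinuousFamily.isClosedEmbedding_restrict hUo hU1 hd
  have : PolishSpace (equicontinuousFamily U) := hcl.polishSpace
  let _ : MeasurableSpace (equicontinuousFamily U) := borel _
  have : BorelSpace (equicontinuousFamily U) := ⟨rfl⟩
  have hev (g : G) (n : ℕ) : Continuous fun φ : equicontinuousFamily U => φ.1 g n :=
    (continuous_apply n).comp ((continuous_apply g).comp continuous_subtype_val)
  have : Nonempty (equicontinuousFamily U) :=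
    ⟨⟨fun _ _ => 0, fun _ _ => by simp, fun _ m _ _ _ => by simp; positivity⟩⟩
  -- A Borel left inverse of restriction defines `Φ` everywhere; off a null set the orbit data
  -- really extend to a member of the family.
  obtain ⟨r, hr, hrid⟩ := hcl.measurableEmbedding.exists_measurable_extend
    measurable_id fun _ => this
  let Φ : X → equicontinuousFamily U := fun x => r fun k n => f n (S.act (d k) x)
  have hΦm : Measurable Φ := hr.comp <| measurable_pi_lambda _ fun k => measurable_pi_lambda _
    fun n => (hf n).comp (S.measurable_act_apply (d k))
  have hΦd : ∀ᵐ x ∂μ, ∀ k n, (Φ x).1 (d k) n = f n (S.act (d k) x) := by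
    have : ∀ᵐ x ∂μ, ∀ n m i j, d j * (d i)⁻¹ ∈ U n m →
        |f n (S.act (d j) x) - f n (S.act (d i) x)| ≤ 1 / ((m : ℝ) + 1) := by
      simp only [ae_all_iff]
      exact fun n m i j h => hae n m _ _ h
    filter_upwards [this] with x hx k n
    obtain ⟨φ, hφ, hφd⟩ := exists_extend_mem_equicontinuousFamily hUo hU1 hd
      (F := fun k n => f n (S.act (d k) x)) (fun _ _ => hf01 _ _) hx
    have : Φ x = ⟨φ, hφ⟩ := by
      have h1 := congrFun hrid ⟨φ, hφ⟩
      simp only [Function.comp_apply, id_eq] at h1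
      rw [← h1]
      exact congrArg r (funext fun k => funext fun n => (hφd k n).symm)
    rw [this]
    exact hφd k n
  -- The null set may depend on `g`: only countably many comparisons, with the `d k` near `g`, are
  -- used.
  have hΦ (g : G) : ∀ᵐ x ∂μ, ∀ n, (Φ x).1 g n = f n (S.act g x) := by
    have : ∀ᵐ x ∂μ, ∀ n m k, d k * g⁻¹ ∈ U n m →
        |f n (S.act (d k) x) - f n (S.act g x)| ≤ 1 / ((m : ℝ) + 1) := by
      simp only [ae_all_iff]
      exact fun n m k h => hae n m _ _ h
    filter_upwards [this, hΦd] with x h1 h2 n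
    refine eq_of_forall_abs_sub_le_two_div fun m => ?_
    obtain ⟨k, hk⟩ := exists_mul_inv_mem_of_denseRange hd (hUo n m) (hU1 n m) g
    have h3 := (Φ x).2.2 n m g _ hk
    rw [inv_mul_cancel_right, h2, abs_sub_comm] at h3
    exact (abs_sub_le _ _ _).trans (add_le_add h3 (h1 n m k hk))
  refine ⟨equicontinuousFamily U, inferInstance, inferInstance, equicontinuousFamily.translate, Φ,
    fun n φ => φ.1 1 n, (equicontinuousFamily.continuous_translate hUo hU1).measurable,
    fun φ => ?_, fun g h φ => ?_, hΦm, fun g => ?_, fun n => (hev 1 n).measurable, fun n => ?_⟩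
  · exact Subtype.ext (funext fun g => by simp [equicontinuousFamily.translate])
  · exact Subtype.ext (funext fun k => by simp [equicontinuousFamily.translate, mul_assoc])
  · have h1 : ∀ᵐ x ∂μ, ∀ k n, (Φ x).1 (d k * g) n = f n (S.act (d k * g) x) :=
      ae_all_iff.2 fun k => hΦ _
    have h2 : ∀ᵐ x ∂μ, ∀ k, S.act (d k) (S.act g x) = S.act (d k * g) x :=
      ae_all_iff.2 fun k => S.act_act _ _
    filter_upwards [h1, h2, S.ae_act hΦd g] with x h1 h2 h3
    refine Subtype.ext (eq_of_mem_equicontinuousFamily hUo hU1 hd (Φ _).2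
      (equicontinuousFamily.translate g (Φ x)).2 fun k n => ?_)
    rw [h3, h2, ← h1]
    rfl
  · filter_upwards [hΦ 1, S.one_act] with x h1 h2
    rw [h1, h2]

/-- Countably many norm continuous functions are measurable, almost everywhere, with respect to a
spatial factor. -/
theorem exists_spatial_factor [IsTopologicalGroup G] [PolishSpace G] [BorelSpace G]
    (S : NearAction G μ) {f : ℕ → X → ℝ} (hf : ∀ n, Measurable (f n))
    (hf01 : ∀ n x, f n x ∈ Icc (0 : ℝ) 1) (hfc : ∀ n, S.IsNormContinuous (f n)) :
    ∃ (Z : Type u) (_ : MeasurableSpace Z) (_ : StandardBorelSpace Z) (Φ : X → Z)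
      (T : NearAction G (μ.map Φ)) (p : ℕ → Z → ℝ), T.IsSpatialAction ∧ IsFactorMap S T Φ ∧
      (∀ n, Measurable (p n)) ∧ ∀ n, ∀ᵐ x ∂μ, p n (Φ x) = f n x := by
  obtain ⟨Z, _, _, a, Φ, p, ha, ha1, hamul, hΦ, hΦa, hp, hpf⟩ :=
    S.exists_equivariant_model hf hf01 hfc
  obtain ⟨W, _, _, ⟨e⟩⟩ := exists_measurableEquiv_standardBorelSpace.{u} Z
  have hΦ' : Measurable fun x => e (Φ x) := e.measurable.comp hΦ
  have hb : Measurable fun q : G × W => e (a q.1 (e.symm q.2)) :=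
    e.measurable.comp (ha.comp (measurable_fst.prodMk (e.symm.measurable.comp measurable_snd)))
  have heq (g : G) : ∀ᵐ x ∂μ, e (Φ (S.act g x)) = e (a g (e.symm (e (Φ x)))) := by
    filter_upwards [hΦa g] with x hx
    rw [hx, e.symm_apply_apply]
  let T : NearAction G (μ.map fun x => e (Φ x)) :=
    { act := fun g w => e (a g (e.symm w))
      measurable_act := hb
      one_act := .of_forall fun w => by simp [ha1]
      act_act := fun g h => .of_forall fun w => by simp [hamul]
      measurePreserving_act := fun g => by
        have hbg : Measurable fun w : W => e (a g (e.symm w)) := hb.comp measurable_prodMk_left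
        refine ⟨hbg, ?_⟩
        rw [Measure.map_map hbg hΦ', Measure.map_congr (g := (fun x => e (Φ x)) ∘ S.act g)
          (f := (fun w => e (a g (e.symm w))) ∘ fun x => e (Φ x))
          ((heq g).mono fun x hx => hx.symm), ← Measure.map_map hΦ' (S.measurable_act_apply g),
          (S.measurePreserving_act g).map_eq] }
  refine ⟨W, inferInstance, inferInstance, fun x => e (Φ x), T, fun n w => p n (e.symm w),
    ⟨fun w => by simp [T, ha1], fun g h w => by simp [T, hamul]⟩, ⟨⟨hΦ', rfl⟩, heq⟩,
    fun n => (hp n).comp e.symm.measurable, fun n => ?_⟩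
  simpa using hpf n

/-- A near-action whose norm continuous functions are dense is spatial. -/
theorem HasDenseNormContinuous.isSpatial [IsTopologicalGroup G] [PolishSpace G] [BorelSpace G]
    [StandardBorelSpace X] [IsProbabilityMeasure μ] {S : NearAction G μ}
    (hS : S.HasDenseNormContinuous) : S.IsSpatial := by
  have hε := measurableEmbedding_sigmoid_comp_embeddingReal X
  set ε : X → unitInterval := unitInterval.sigmoid ∘ embeddingReal X
  have hX : Nonempty X := nonempty_of_isProbabilityMeasure μ
  let e : X → ℝ := fun x => ε x
  have he : MeasurableEmbedding e :=
    (MeasurableEmbedding.subtype_coe measurableSet_Icc).comp hε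
  have happ (n : ℕ) := hS e he.measurable (fun x => (ε x).2) ((n : ENNReal) + 1)⁻¹ (by simp)
  choose f hf hf01 hfc hfe using happ
  obtain ⟨Z, _, _, Φ, T, p, hT, hΦ, hp, hpf⟩ := S.exists_spatial_factor hf hf01 hfc
  have hmeas : TendstoInMeasure μ f atTop e := by
    refine tendstoInMeasure_of_tendsto_eLpNorm (p := 1) one_ne_zero
      (fun n => (hf n).aestronglyMeasurable) he.measurable.aestronglyMeasurable ?_
    refine tendsto_of_tendsto_of_tendsto_of_le_of_le tendsto_const_nhds ?_
      (fun _ => zero_le) hfe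
    have := ENNReal.tendsto_inv_nat_nhds_zero.comp (tendsto_add_atTop_nat 1)
    simpa [Function.comp_def] using this
  obtain ⟨ns, -, hns⟩ := hmeas.exists_seq_tendsto_ae
  -- An almost everywhere convergent subsequence recovers the embedding `e` from `Φ`, so `Φ` has a
  -- Borel left inverse almost everywhere.
  let q : Z → ℝ := fun z => limsup (fun i => p (ns i) z) atTop
  have hq : Measurable q := Measurable.limsup fun i => hp (ns i)
  have hqe : ∀ᵐ x ∂μ, q (Φ x) = e x := by
    filter_upwards [hns, ae_all_iff.2 hpf] with x h1 h2
    simp only [q, h2]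
    exact h1.limsup_eq
  obtain ⟨r, hr, hre⟩ := he.exists_measurable_extend measurable_id fun _ => hX
  have hψ : ∀ᵐ x ∂μ, r (q (Φ x)) = x := by
    filter_upwards [hqe] with x hx
    rw [hx]
    exact congrFun hre x
  have hψm : Measurable fun z => r (q z) := hr.comp hq
  have hae {P : Z → Prop} (hP : MeasurableSet {z | P z}) (h : ∀ᵐ x ∂μ, P (Φ x)) :
      ∀ᵐ z ∂(μ.map Φ), P z := (ae_map_iff hΦ.1.measurable.aemeasurable hP).2 h
  refine ⟨Z, inferInstance, inferInstance, μ.map Φ,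
    Measure.isProbabilityMeasure_map hΦ.1.measurable.aemeasurable, T, hT,
    Φ, fun z => r (q z), hΦ, ⟨⟨hψm, ?_⟩, fun g => ?_⟩, hψ, ?_⟩
  · rw [Measure.map_map hψm hΦ.1.measurable,
      Measure.map_congr (f := (fun z => r (q z)) ∘ Φ) (g := id) hψ, Measure.map_id]
  · refine hae (measurableSet_eq_fun (hψm.comp (T.measurable_act_apply g))
      ((S.measurable_act_apply g).comp hψm)) ?_
    filter_upwards [hΦ.2 g, hψ, S.ae_act hψ g] with x h1 h2 h3
    rw [← h1, h3, h2]
  · refine hae (measurableSet_eq_fun (hΦ.1.measurable.comp hψm) measurable_id) ?_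
    filter_upwards [hψ] with x hx
    rw [hx]

theorem IsSpatial.hasDenseNormContinuous [IsTopologicalGroup G] [PolishSpace G] [BorelSpace G]
    [IsProbabilityMeasure μ] {S : NearAction G μ} (hS : S.IsSpatial) :
    S.HasDenseNormContinuous := by
  obtain ⟨Y, _, _, ν, _, T, hT, φ, ψ, -, hψ, -, -⟩ := hS
  exact hT.hasDenseNormContinuous.of_isFactorOf ⟨ψ, hψ⟩

end NearAction

/-! ### Essential infima -/

/-- The essential infimum of a family of measurable functions is attained on a countable
subfamily. -/
theorem exists_seq_forall_ae_iInf_le {X ι : Type*} [MeasurableSpace X] {μ : Measure X}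
    [IsFiniteMeasure μ] [Nonempty ι] {u : ι → X → ENNReal} (hu : ∀ i, Measurable (u i))
    (hu1 : ∀ i x, u i x ≤ 1) : ∃ s : ℕ → ι, ∀ i, ∀ᵐ x ∂μ, ⨅ k, u (s k) x ≤ u i x := by
  let w (s : ℕ → ι) : ENNReal := ∫⁻ x, ⨅ k, u (s k) x ∂μ
  have hw (s : ℕ → ι) : w s ≠ ⊤ := by
    refine ne_top_of_le_ne_top (measure_ne_top μ univ) ?_
    calc w s ≤ ∫⁻ _, 1 ∂μ := lintegral_mono fun x => (iInf_le _ 0).trans (hu1 _ _)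
      _ = μ univ := by simp
  have hI : (⨅ s, w s) ≠ ⊤ :=
    ne_top_of_le_ne_top (hw fun _ => Classical.arbitrary ι) (iInf_le _ _)
  have happ (n : ℕ) : ∃ s, w s < (⨅ s, w s) + ((n : ENNReal) + 1)⁻¹ :=
    iInf_lt_iff.1 (ENNReal.lt_add_right hI (by simp))
  choose t ht using happ
  -- Merging all the nearly optimal sequences gives one attaining the minimal integral.
  let s : ℕ → ι := fun j => t j.unpair.1 j.unpair.2
  have hs : w s ≤ ⨅ s, w s := by
    have h1 (n : ℕ) : w s ≤ (⨅ s, w s) + ((n : ENNReal) + 1)⁻¹ := by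
      refine le_trans (lintegral_mono fun x => le_iInf fun k => ?_) (ht n).le
      refine (iInf_le _ (Nat.pair n k)).trans ?_
      simp [s]
    refine ge_of_tendsto' (x := atTop) ?_ h1
    have := (ENNReal.tendsto_inv_nat_nhds_zero.comp (tendsto_add_atTop_nat 1)).const_add (⨅ s, w s)
    simpa [Function.comp_def] using this
  refine ⟨s, fun i => ?_⟩
  -- Prepending `i` cannot lower the minimal integral, so it leaves the infimum unchanged almost
  -- everywhere.
  let s' : ℕ → ι := fun k => Nat.casesOn k i s
  have hle : ∀ x, ⨅ k, u (s' k) x ≤ ⨅ k, u (s k) x := fun x =>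
    le_iInf fun k => iInf_le (fun k => u (s' k) x) (k + 1)
  have := ae_eq_of_ae_le_of_lintegral_le (μ := μ) (.of_forall hle) (hw s')
    (Measurable.iInf fun k => hu (s k)).aemeasurable (hs.trans (iInf_le _ s'))
  filter_upwards [this] with x hx
  rw [← hx]
  exact iInf_le (fun k => u (s' k) x) 0

/-! ### Joinings and whirly systems -/

namespace NearAction

variable {G : Type v} [Group G] [MeasurableSpace G]
  {X Y : Type u} [MeasurableSpace X] [MeasurableSpace Y] {μ : Measure X} {ν : Measure Y}

/-- The diagonal near-action on a joining. -/
def IsJoining.nearAction {S : NearAction G μ} {T : NearAction G ν} {l : Measure (X × Y)}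
    (hl : IsJoining S T l) : NearAction G l :=
  have hX : MeasurePreserving Prod.fst l μ := ⟨measurable_fst, hl.1⟩
  have hY : MeasurePreserving Prod.snd l ν := ⟨measurable_snd, hl.2.1⟩
  { act := fun g => Prod.map (S.act g) (T.act g)
    measurable_act :=
      (S.measurable_act.comp (measurable_fst.prodMk (measurable_fst.comp measurable_snd))).prodMk
        (T.measurable_act.comp (measurable_fst.prodMk (measurable_snd.comp measurable_snd)))
    one_act := by
      filter_upwards [hX.quasiMeasurePreserving.ae S.one_act,
        hY.quasiMeasurePreserving.ae T.one_act] with p h1 h2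
      exact Prod.ext h1 h2
    act_act := fun g h => by
      filter_upwards [hX.quasiMeasurePreserving.ae (S.act_act g h),
        hY.quasiMeasurePreserving.ae (T.act_act g h)] with p h1 h2
      exact Prod.ext h1 h2
    measurePreserving_act := fun g =>
      ⟨(S.measurable_act_apply g).prodMap (T.measurable_act_apply g), hl.2.2 g⟩ }

/-- The graph of a factor map is a joining. -/
theorem IsFactorMap.isJoining {S : NearAction G μ} {T : NearAction G ν} {π : X → Y}
    (hπ : IsFactorMap S T π) : IsJoining S T (μ.map fun x => (x, π x)) := by
  have hm : Measurable fun x => (x, π x) := measurable_id.prodMk hπ.1.measurable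
  refine ⟨?_, ?_, fun g => ?_⟩
  · rw [Measure.map_map measurable_fst hm]
    exact Measure.map_id
  · rw [Measure.map_map measurable_snd hm]
    exact hπ.1.map_eq
  · rw [Measure.map_map ((S.measurable_act_apply g).prodMap (T.measurable_act_apply g)) hm,
      Measure.map_congr (f := Prod.map (S.act g) (T.act g) ∘ fun x => (x, π x))
        (g := (fun x => (x, π x)) ∘ S.act g), ← Measure.map_map hm (S.measurable_act_apply g),
      (S.measurePreserving_act g).map_eq]
    filter_upwards [hπ.2 g] with x hx
    exact Prod.ext rfl hx.symm

theorem IsSpatialAction.isSpatial [StandardBorelSpace X] [IsProbabilityMeasure μ]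
    {S : NearAction G μ} (hS : S.IsSpatialAction) : S.IsSpatial := by
  have hid : IsFactorMap S S id := ⟨MeasurePreserving.id μ, fun g => .of_forall fun _ => rfl⟩
  exact ⟨X, inferInstance, inferInstance, μ, inferInstance, S, hS, id, id, hid, hid,
    .of_forall fun _ => rfl, .of_forall fun _ => rfl⟩

variable [TopologicalSpace G]

/-- Norm continuous functions on a whirly system are constant. -/
theorem IsWhirly.ae_eq_integral [IsTopologicalGroup G] [IsProbabilityMeasure μ] {R : NearAction G μ}
    (hR : R.IsWhirly) {k : X → ℝ} (hk : Measurable k) (hki : Integrable k μ)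
    (hkc : R.IsNormContinuous k) : ∀ᵐ x ∂μ, k x = ∫ x, k x ∂μ := by
  set c := ∫ x, k x ∂μ with hc
  have hA : 0 < μ {x | k x ≤ c} := measure_le_integral_pos hki
  have hB (b : ℝ) (hb : c < b) : ∀ᵐ x ∂μ, k x ≤ b := by
    by_contra hne
    have hB : 0 < μ {x | b < k x} := by
      rw [pos_iff_ne_zero]
      intro h
      refine hne (measure_mono_null (fun x hx => ?_) h)
      exact lt_of_not_ge (show ¬ k x ≤ b from hx)
    -- Some `g⁻¹` close to `1` carries points with `k ≤ c` to points with `k > b`, a jump exceeding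
    -- the allowed `(b - c) / 2`.
    obtain ⟨g, hg, hpos⟩ := hR _ _ (measurableSet_le hk measurable_const)
      (measurableSet_lt measurable_const hk) hA hB _
      (inv_mem_nhds_one G (hkc ((b - c) / 2) (by linarith)))
    have hg' : ∀ᵐ x ∂μ, |k (R.act g⁻¹ x) - k x| ≤ (b - c) / 2 := hg
    refine hpos.ne' (measure_mono_null ?_ hg')
    rintro x ⟨hx1, hx2⟩ hx
    have h1 : k x ≤ c := hx1
    have h2 : b < k (R.act g⁻¹ x) := hx2
    have h3 := (abs_le.1 (show |k (R.act g⁻¹ x) - k x| ≤ (b - c) / 2 from hx)).2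
    linarith
  have hle : ∀ᵐ x ∂μ, k x ≤ c := by
    have : ∀ᵐ x ∂μ, ∀ n : ℕ, k x ≤ c + 1 / ((n : ℝ) + 1) :=
      ae_all_iff.2 fun n => hB _ (lt_add_of_pos_right _ (by positivity))
    filter_upwards [this] with x hx
    refine ge_of_tendsto' (x := atTop) ?_ hx
    simpa using (tendsto_one_div_add_atTop_nhds_zero_nat (𝕜 := ℝ)).const_add c
  exact (integral_eq_iff_of_ae_le hki (integrable_const c) hle).1 (by simp [hc])

/-- The projection to `X` of a norm continuous function on `Y` is constant, so such functions are
independent of `X` under any joining; density extends this to indicators. -/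
theorem IsWhirly.isDisjointFrom [IsTopologicalGroup G] [IsProbabilityMeasure μ]
    [IsProbabilityMeasure ν] {R : NearAction G μ} (hR : R.IsWhirly) {S : NearAction G ν}
    (hS : S.HasDenseNormContinuous) : R.IsDisjointFrom S := by
  intro l hl
  have hX : MeasurePreserving Prod.fst l μ := ⟨measurable_fst, hl.1⟩
  have hY : MeasurePreserving Prod.snd l ν := ⟨measurable_snd, hl.2.1⟩
  have : IsProbabilityMeasure l := ⟨by
    have := hX.measure_preimage (s := univ) nullMeasurableSet_univ
    simpa using this⟩
  have hfst : IsFactorMap hl.nearAction R Prod.fst := ⟨hX, fun g => .of_forall fun _ => rfl⟩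
  have key (f : Y → ℝ) (hf : Measurable f) (hf01 : ∀ y, f y ∈ Icc (0 : ℝ) 1)
      (hfc : S.IsNormContinuous f) (A : Set X) (hA : MeasurableSet A) :
      ∫ p in Prod.fst ⁻¹' A, f p.2 ∂l = μ.real A * ∫ y, f y ∂ν := by
    have hf' : Measurable fun p : X × Y => f p.2 := hf.comp measurable_snd
    have hfi : Integrable (fun p : X × Y => f p.2) l := integrable_of_mem_Icc hf' fun _ => hf01 _
    obtain ⟨k, hk, hk01, hkc, hke⟩ := hfst.exists_isNormContinuous_condExp hf' (fun _ => hf01 _)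
      fun ε hε => (hfc ε hε).mono fun g hg => hY.quasiMeasurePreserving.ae hg
    have hint (A : Set X) (hA : MeasurableSet A) :
        ∫ p in Prod.fst ⁻¹' A, f p.2 ∂l = ∫ x in A, k x ∂μ := by
      rw [← setIntegral_condExp hX.measurable.comap_le hfi ⟨A, hA, rfl⟩,
        ← MeasurePreserving.setIntegral_preimage_of_measurable hX hk hA]
      exact setIntegral_congr_ae (hX.measurable hA) (hke.mono fun x hx _ => hx.symm)
    have hconst := hR.ae_eq_integral hk (integrable_of_mem_Icc hk hk01) hkc
    have htot : ∫ x, k x ∂μ = ∫ y, f y ∂ν := by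
      have h1 := hint univ .univ
      have h2 := MeasurePreserving.setIntegral_preimage_of_measurable hY hf .univ
      simp only [preimage_univ, setIntegral_univ] at h1 h2
      rw [← h1, h2]
    rw [hint A hA, setIntegral_congr_ae hA (hconst.mono fun x hx _ => hx), htot]
    simp
  refine (Measure.prod_eq fun A C hA hC => ?_).symm
  let e : Y → ℝ := C.indicator 1
  have he : Measurable e := measurable_one.indicator hC
  have he01 (y : Y) : e y ∈ Icc (0 : ℝ) 1 :=
    ⟨indicator_nonneg (fun _ _ => zero_le_one) _, indicator_le_self' (fun _ _ => zero_le_one) _⟩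
  have hei : Integrable e ν := integrable_of_mem_Icc he he01
  have hel : Integrable (fun p : X × Y => e p.2) l :=
    integrable_of_mem_Icc (he.comp measurable_snd) fun _ => he01 _
  have hval : ∫ p in Prod.fst ⁻¹' A, e p.2 ∂l = μ.real A * ∫ y, e y ∂ν := by
    refine eq_of_forall_abs_sub_le_two_div fun m => ?_
    obtain ⟨f, hf, hf01, hfc, hfe⟩ := hS e he he01 (ENNReal.ofReal (1 / ((m : ℝ) + 1)))
      (ENNReal.ofReal_pos.2 (by positivity)).ne'
    have hfi : Integrable f ν := integrable_of_mem_Icc hf hf01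
    have hfl : Integrable (fun p : X × Y => f p.2) l :=
      integrable_of_mem_Icc (hf.comp measurable_snd) fun _ => hf01 _
    have h0 : ∫ y, |e y - f y| ∂ν ≤ 1 / ((m : ℝ) + 1) := by
      rw [eLpNorm_one_eq_lintegral_enorm,
        ← ofReal_integral_norm_eq_lintegral_enorm (hfi.sub hei),
        ENNReal.ofReal_le_ofReal_iff (by positivity)] at hfe
      simpa only [Pi.sub_apply, Real.norm_eq_abs, abs_sub_comm] using hfe
    have h1 : |∫ p in Prod.fst ⁻¹' A, e p.2 ∂l - ∫ p in Prod.fst ⁻¹' A, f p.2 ∂l|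
        ≤ 1 / ((m : ℝ) + 1) := by
      rw [← integral_sub hel.integrableOn hfl.integrableOn]
      refine abs_integral_le_integral_abs.trans (le_trans ?_ h0)
      have h2 := MeasurePreserving.setIntegral_preimage_of_measurable hY
        (k := fun y => |e y - f y|) (continuous_abs.measurable.comp (he.sub hf)) .univ
      simp only [preimage_univ, setIntegral_univ] at h2
      rw [← h2]
      exact setIntegral_le_integral (hel.sub hfl).abs (.of_forall fun _ => abs_nonneg _)
    have h2 : |∫ p in Prod.fst ⁻¹' A, f p.2 ∂l - μ.real A * ∫ y, e y ∂ν|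
        ≤ 1 / ((m : ℝ) + 1) := by
      rw [key f hf hf01 hfc A hA, ← mul_sub, ← integral_sub hfi hei, abs_mul,
        abs_of_nonneg measureReal_nonneg]
      refine (mul_le_of_le_one_left (abs_nonneg _) measureReal_le_one).trans ?_
      refine abs_integral_le_integral_abs.trans (le_trans (le_of_eq ?_) h0)
      simp only [abs_sub_comm]
    exact (abs_sub_le _ _ _).trans (add_le_add h1 h2)
  have h1 : ∫ p in Prod.fst ⁻¹' A, e p.2 ∂l = l.real (A ×ˢ C) := by
    have : (fun p : X × Y => e p.2) = (Prod.snd ⁻¹' C).indicator 1 := rfl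
    rw [this, integral_indicator_one (measurable_snd hC),
      measureReal_restrict_apply (measurable_snd hC), inter_comm]
    rfl
  have h2 : ∫ y, e y ∂ν = ν.real C := integral_indicator_one hC
  rw [h1, h2] at hval
  rw [← ENNReal.toReal_eq_toReal_iff' (measure_ne_top _ _)
    (ENNReal.mul_ne_top (measure_ne_top _ _) (measure_ne_top _ _)), ENNReal.toReal_mul]
  exact hval

open Classical in
/-- If the translates of `B` by a neighbourhood of the identity miss `A`, then a norm continuous
function separates `A` from `B`. -/
theorem exists_isNormContinuous_separating [IsTopologicalGroup G] [FirstCountableTopology G]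
    [IsProbabilityMeasure μ] (R : NearAction G μ) {A B : Set X} (hB : MeasurableSet B)
    {U : Set G} (hU : U ∈ 𝓝 (1 : G)) (hAB : ∀ g ∈ U, μ (A ∩ R.act g⁻¹ ⁻¹' B) = 0) :
    ∃ f : X → ℝ, Measurable f ∧ (∀ x, f x ∈ Icc (0 : ℝ) 1) ∧ R.IsNormContinuous f ∧
      (∀ᵐ x ∂μ, x ∈ B → f x = 0) ∧ ∃ δ > 0, ∀ᵐ x ∂μ, x ∈ A → δ ≤ f x := by
  obtain ⟨ρ, hρ⟩ := exists_groupSeminorm_nhds_one_eq_comap G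
  have hρ0 : Tendsto ρ (𝓝 1) (𝓝 0) := hρ ▸ tendsto_comap
  -- The infimum of `u g x` over `g` is the truncated `ρ`-distance from `1` to the elements moving
  -- `x` into `B`. The essential infimum replaces it, being measurable and below each `u g` almost
  -- everywhere.
  let u (g : G) (x : X) : ENNReal :=
    if R.act g x ∈ B then min 1 (ENNReal.ofReal (ρ g)) else 1
  have hu (g : G) : Measurable (u g) :=
    Measurable.ite (R.measurable_act_apply g hB) measurable_const measurable_const
  have hu1 (g : G) (x : X) : u g x ≤ 1 := by
    simp only [u]
    split_ifs
    exacts [min_le_left _ _, le_rfl]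
  obtain ⟨s, hs⟩ := exists_seq_forall_ae_iInf_le (μ := μ) hu hu1
  let F (x : X) : ENNReal := ⨅ k, u (s k) x
  have hF1 (x : X) : F x ≤ 1 := (iInf_le _ 0).trans (hu1 _ _)
  have hFtop (x : X) : F x ≠ ⊤ := ne_top_of_le_ne_top ENNReal.one_ne_top (hF1 x)
  have hstep (h : G) : ∀ᵐ x ∂μ, F x ≤ F (R.act h x) + ENNReal.ofReal (ρ h) := by
    have h1 : ∀ᵐ x ∂μ, ∀ k, F x ≤ u (s k * h) x := ae_all_iff.2 fun k => hs _
    have h2 : ∀ᵐ x ∂μ, ∀ k, R.act (s k) (R.act h x) = R.act (s k * h) x :=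
      ae_all_iff.2 fun k => R.act_act _ _
    filter_upwards [h1, h2] with x h1 h2
    rw [ENNReal.iInf_add]
    refine le_iInf fun k => (h1 k).trans ?_
    simp only [u, h2]
    split_ifs
    · rw [min_add]
      refine le_min ((min_le_left _ _).trans le_self_add) ((min_le_right _ _).trans ?_)
      rw [← ENNReal.ofReal_add (apply_nonneg ρ _) (apply_nonneg ρ _)]
      exact ENNReal.ofReal_le_ofReal (map_mul_le_add ρ _ _)
    · exact le_self_add
  have hstep' (h : G) : ∀ᵐ x ∂μ, (F x).toReal ≤ (F (R.act h x)).toReal + ρ h := by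
    filter_upwards [hstep h] with x hx
    have := ENNReal.toReal_mono (ENNReal.add_ne_top.2 ⟨hFtop _, ENNReal.ofReal_ne_top⟩) hx
    rwa [ENNReal.toReal_add (hFtop _) ENNReal.ofReal_ne_top,
      ENNReal.toReal_ofReal (apply_nonneg ρ h)] at this
  refine ⟨fun x => (F x).toReal, (Measurable.iInf fun k => hu (s k)).ennreal_toReal,
    fun x => ⟨ENNReal.toReal_nonneg,
      ENNReal.toReal_le_of_le_ofReal zero_le_one (by simpa using hF1 x)⟩,
    fun ε hε => ?_, ?_, ?_⟩
  · filter_upwards [hρ0.eventually (Iio_mem_nhds hε)] with g hg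
    filter_upwards [hstep' g, R.ae_act (hstep' g⁻¹) g, R.ae_act_inv_act g] with x h1 h2 h3
    rw [h3, map_inv_eq_map] at h2
    have h4 : ρ g < ε := hg
    rw [abs_le]
    constructor <;> linarith
  · filter_upwards [hs 1, R.one_act] with x h1 h2 hx
    have h3 : F x ≤ 0 := by
      refine h1.trans ?_
      simp [u, h2, hx]
    simp [le_antisymm h3 zero_le]
  · rw [hρ] at hU
    obtain ⟨N, hN, hNU⟩ := hU
    obtain ⟨δ, hδ, hδN⟩ := Metric.mem_nhds_iff.1 hN
    refine ⟨min 1 δ, lt_min one_pos hδ, ?_⟩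
    -- The sets missing `A` are preimages under `g⁻¹`, hence the inverse; it is harmless as `ρ` is
    -- symmetric.
    have h1 : ∀ᵐ x ∂μ, ∀ k, (s k)⁻¹ ∈ U → x ∈ A → R.act (s k) x ∉ B := by
      refine ae_all_iff.2 fun k => ?_
      by_cases hk : (s k)⁻¹ ∈ U
      · have := hAB _ hk
        rw [inv_inv] at this
        filter_upwards [measure_eq_zero_iff_ae_notMem.1 this] with x hx _ hxA hxB
        exact hx ⟨hxA, hxB⟩
      · exact .of_forall fun x h => absurd h hk
    filter_upwards [h1] with x hx hxA
    rw [← ENNReal.ofReal_le_iff_le_toReal (hFtop x)]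
    refine le_iInf fun k => ?_
    simp only [u]
    split_ifs with hk
    · rw [ENNReal.ofReal_min, ENNReal.ofReal_one]
      refine min_le_min_left _ (ENNReal.ofReal_le_ofReal ?_)
      by_contra! hlt
      refine hx k (hNU (hδN ?_)) hxA hk
      rw [map_inv_eq_map, Metric.mem_ball, Real.dist_eq, sub_zero,
        abs_of_nonneg (apply_nonneg ρ _)]
      exact hlt
    · rw [ENNReal.ofReal_le_one]
      exact min_le_left _ _

/-- A separating function descends to a spatial factor. The graph joining gives measure zero to `A`
times the region where it is below `δ`, but the product measure does not, as that region pulls back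
to a set containing almost all of `B`. -/
theorem isWhirly_of_forall_isDisjointFrom [IsTopologicalGroup G] [PolishSpace G] [BorelSpace G]
    [IsProbabilityMeasure μ] {R : NearAction G μ}
    (hR : ∀ (Y : Type u) [MeasurableSpace Y] [StandardBorelSpace Y] (ν : Measure Y)
      [IsProbabilityMeasure ν] (S : NearAction G ν), S.IsSpatial → R.IsDisjointFrom S) :
    R.IsWhirly := by
  intro A B hA hB hA0 hB0 U hU
  by_contra! hAB
  obtain ⟨f, hf, hf01, hfc, hfB, δ, hδ, hfA⟩ := R.exists_isNormContinuous_separating hB hU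
    fun g hg => le_antisymm (hAB g hg) zero_le
  obtain ⟨Z, _, _, Φ, T, p, hT, hΦ, hp, hpf⟩ :=
    R.exists_spatial_factor (f := fun _ => f) (fun _ => hf) (fun _ => hf01) fun _ => hfc
  have := Measure.isProbabilityMeasure_map (μ := μ) hΦ.1.measurable.aemeasurable
  have hl := hR Z (μ.map Φ) T hT.isSpatial _ hΦ.isJoining
  have hC : MeasurableSet {z | p 0 z < δ} := measurableSet_lt (hp 0) measurable_const
  have h1 := congrArg (fun l : Measure (X × Z) => l (A ×ˢ {z | p 0 z < δ})) hl
  simp only [Measure.prod_prod] at h1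
  rw [Measure.map_apply (measurable_id'.prodMk hΦ.1.measurable) (hA.prod hC),
    Measure.map_apply hΦ.1.measurable hC] at h1
  have h2 : μ ((fun x => (x, Φ x)) ⁻¹' (A ×ˢ {z | p 0 z < δ})) = 0 := by
    refine measure_eq_zero_iff_ae_notMem.2 ?_
    filter_upwards [hfA, hpf 0] with x hx1 hx2 hx
    have h3 : p 0 (Φ x) < δ := hx.2
    rw [hx2] at h3
    exact absurd (hx1 hx.1) (not_le.2 h3)
  have h3 : μ B ≤ μ (Φ ⁻¹' {z | p 0 z < δ}) := by
    refine measure_mono_ae ?_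
    filter_upwards [hfB, hpf 0] with x hx1 hx2 hx
    have : p 0 (Φ x) < δ := by rw [hx2, hx1 hx]; exact hδ
    exact this
  rw [h2] at h1
  exact (ENNReal.mul_pos hA0.ne' (hB0.trans_le h3).ne').ne h1

end NearAction

/-! ### The main theorem -/

theorem mainTheorem8 {G : Type v} [Group G] [TopologicalSpace G] [IsTopologicalGroup G]
    [PolishSpace G] [MeasurableSpace G] [BorelSpace G] :
    (∀ (Y Z : Type u) [MeasurableSpace Y] [StandardBorelSpace Y]
        [MeasurableSpace Z] [StandardBorelSpace Z]
        (ν : Measure Y) [IsProbabilityMeasure ν] (η : Measure Z) [IsProbabilityMeasure η]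
        (S : NearAction G ν) (T : NearAction G η),
        S.IsSpatial → T.IsFactorOf S → T.IsSpatial) ∧
    (∀ (X : Type u) [MeasurableSpace X] [StandardBorelSpace X]
        (μ : Measure X) [IsProbabilityMeasure μ] (R : NearAction G μ),
        R.IsWhirly ↔
          ∀ (Y : Type u) [MeasurableSpace Y] [StandardBorelSpace Y]
            (ν : Measure Y) [IsProbabilityMeasure ν] (S : NearAction G ν),
            S.IsSpatial → R.IsDisjointFrom S) :=
  ⟨fun _ _ _ _ _ _ _ _ _ _ _ _ hS hT => (hS.hasDenseNormContinuous.of_isFactorOf hT).isSpatial,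
    fun _ _ _ _ _ _ => ⟨fun hR _ _ _ _ _ _ hS => hR.isDisjointFrom hS.hasDenseNormContinuous,
      NearAction.isWhirly_of_forall_isDisjointFrom⟩⟩
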